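/- Let $n\ge 1$ and $k\ge 0$. For a complex manifold $Z$ with an analytic distribution $D$ of rank $n$, let $\pi:\mathbb P D\to Z$ be the manifold of pairs $(z,\ell)$ with $z\in Z$ and $\ell\subset D(z)$ a line, with the rank $n$ distribution $D^1(z,\ell)=d\pi_{(z,\ell)}^{-1}(\ell)$. Put $\mathcal P^0(n)=\mathbb C^n$, $\Delta_0=T\mathbb C^n$, and $(\mathcal P^{j+1}(n),\Delta_{j+1})=(\mathbb P\Delta_j,\Delta_j^1)$; let $\pi_{k,i}:\mathcal P^k(n)\to\mathcal P^i(n)$ be the projections. The prolongation of a non-constant analytic integral curve germ $\gamma$ of $D$ is the analytic curve germ $\gamma^1$ with $\gamma^1(t)=(\gamma(t),\mathrm{span}\,\gamma'(t))$ at regular points (extended by the limit at $t=0$), and $\gamma^k$ is the $k$-th iterate for a curve germ in $\mathbb C^n$. A point $p\in\mathcal P^k(n)$ is a *Cartan point* if there is an analytic curve germ $\gamma$ in $\mathbb C^n$ with $\gamma'(0)\neq0$, $\gamma^k(0)=p$ and $\gamma^k$ immersed. Local analytic diffeomorphisms $\psi$ of $\mathbb C^n$ act by prolongation, $\psi^{j+1}(z,\ell)=(\psi^j(z),d\psi^j_z(\ell))$;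 $p\sim q$ if $\psi^k(p)=q$ for some $\psi$ defined near $\pi_{k,0}(p)$, and the classes of $\sim$ are called orbits. A point $(z,\ell)$ of level at least $2$ is *vertical* if $\ell$ lies in the kernel of the differential at $z$ of the projection one level down; points of level $0$ and $1$ are not vertical. For a fiber $F$ of $\mathcal P^i(n)\to\mathcal P^{i-1}(n)$, $i\ge1$, put $\mathcal P^0(F)=F$ and $\mathcal P^{j+1}(F)=\{(q,\ell): q\in\mathcal P^j(F),\ \ell\subset \Delta_{i+j}(q)\cap T_q\mathcal P^j(F)\}\subset\mathcal P^{i+j+1}(n)$. A point $(q,\ell)$ is *critical* if $\ell\subset T_q\mathcal P^j(F)$ for some such $F$ and $j$ with $q\in\mathcal P^j(F)$, and *regular* otherwise. The code of $p\in\mathcal P^k(n)$ is the word $w_1\dots w_k$ where, with $p_i=\pi_{k,i}(p)$, $w_i=V$ if $p_i$ is vertical, $w_i=T$ if $p_i$ is critical but not vertical, and $w_i=R$ if $p_i$ is regular. Then: 1. A point $p\in\mathcal P^k(n)$ is a Cartan point if and only if none of the points $p_i=\pi_{k,i}(p)$, $0\le i\le k$, is vertical; equivalently, if and only if its code is $R^k$.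 2. The Cartan points of $\mathcal P^k(n)$ form a single orbit, which is open and dense. If $k\ge2$, its complement is a complex analytic hypersurface (locally the zero set of one analytic function that does not vanish identically on any nonempty open set), which is non-empty when $n\ge2$. 3. Near any Cartan point, $(\mathcal P^k(n),\Delta_k)$ is locally analytically diffeomorphic to the space $J^k(\mathbb C,\mathbb C^{n-1})$ of $k$-jets of analytic maps, with coordinates $(x,u_0,\dots,u_k)$, $u_j\in\mathbb C^{n-1}$, endowed with its canonical distribution $du_j=u_{j+1}\,dx$, $0\le j<k$. 4. Every point of $\mathcal P^1(n)$ is a Cartan point. -/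

import Mathlib

open Set Filter Topology
open scoped Manifold ContDiff LinearAlgebra.Projectivization

noncomputable section

namespace Monster

section Prolongation

variable {E : Type} [NormedAddCommGroup E] [NormedSpace ℂ E]
  {M : Type} [TopologicalSpace M] [ChartedSpace E M]

/-- An analytic chart of `M` together with an analytic frame of `D` over it, read in the chart.
The coframe is a left inverse of the frame, so the `r + 1` frame fields are linearly independent;
by `mem_iff` they span `D` at each point of the chart domain. -/
structure FrameChart (r : ℕ) (D : ∀ p : M, Submodule ℂ (TangentSpace 𝓘(ℂ, E) p)) where
  chart : OpenPartialHomeomorph M E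
  frame : E → (Fin (r + 1) → ℂ) →L[ℂ] E
  coframe : E → E →L[ℂ] (Fin (r + 1) → ℂ)
  mem_maximalAtlas : chart ∈ IsManifold.maximalAtlas 𝓘(ℂ, E) ω M
  contDiffOn_frame : ContDiffOn ℂ ω frame chart.target
  contDiffOn_coframe : ContDiffOn ℂ ω coframe chart.target
  coframe_frame : ∀ x ∈ chart.target, ∀ a, coframe x (frame x a) = a
  mem_iff : ∀ p ∈ chart.source, ∀ v : TangentSpace 𝓘(ℂ, E) p,
    v ∈ D p ↔ ∃ a, frame (chart p) a = mfderiv 𝓘(ℂ, E) 𝓘(ℂ, E) chart p v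

variable (E M) in
/-- An analytic distribution of rank `r + 1` on the complex manifold `M`: a field of subspaces of
the tangent spaces which near every point is spanned by `r + 1` independent analytic fields. -/
structure Distribution (r : ℕ) where
  space : ∀ p : M, Submodule ℂ (TangentSpace 𝓘(ℂ, E) p)
  exists_frame : ∀ p : M, ∃ f : FrameChart r space, p ∈ f.chart.source

/-- The projectivization `ℙD` of a distribution: pairs of a point `z` and a line in `D z`. -/
structure Prolong {r : ℕ} (D : Distribution E M r) where
  base : M
  line : ℙ ℂ (D.space base)

variable {r : ℕ} {D : Distribution E M r}

namespace FrameChart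

variable (f : FrameChart r D.space)

/-- The components, in the frame, of a tangent vector. -/
def coord (p : M) (v : TangentSpace 𝓘(ℂ, E) p) : Fin (r + 1) → ℂ :=
  f.coframe (f.chart p) (mfderiv 𝓘(ℂ, E) 𝓘(ℂ, E) f.chart p v)

/-- The vector at the point with chart coordinates `x` which has components `a` in the frame. -/
def vec (x : E) (a : Fin (r + 1) → ℂ) : TangentSpace 𝓘(ℂ, E) (f.chart.symm x) :=
  mfderiv 𝓘(ℂ, E) 𝓘(ℂ, E) f.chart.symm x (f.frame x a)

lemma coord_smul (p : M) (c : ℂ) (v : TangentSpace 𝓘(ℂ, E) p) :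
    f.coord p (c • v) = c • f.coord p v := by
  rw [coord, ContinuousLinearMap.map_smul]
  exact (f.coframe (f.chart p)).map_smul c _

lemma coord_zero (p : M) : f.coord p 0 = 0 := by
  rw [coord, ContinuousLinearMap.map_zero]
  exact (f.coframe (f.chart p)).map_zero

end FrameChart

namespace FrameChart

variable (f g : FrameChart r D.space)

lemma mdiff : f.chart.MDifferentiable 𝓘(ℂ, E) 𝓘(ℂ, E) :=
  ⟨(contMDiffOn_of_mem_maximalAtlas f.mem_maximalAtlas).mdifferentiableOn (by simp),
    (contMDiffOn_symm_of_mem_maximalAtlas f.mem_maximalAtlas).mdifferentiableOn (by simp)⟩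

lemma mfderiv_vec {x : E} (hx : x ∈ f.chart.target) (a : Fin (r + 1) → ℂ) :
    mfderiv 𝓘(ℂ, E) 𝓘(ℂ, E) f.chart (f.chart.symm x) (f.vec x a) = f.frame x a := by
  have h := f.mdiff.comp_symm_deriv hx
  exact DFunLike.congr_fun h (f.frame x a)

lemma coord_vec {x : E} (hx : x ∈ f.chart.target) (a : Fin (r + 1) → ℂ) :
    f.coord (f.chart.symm x) (f.vec x a) = a := by
  rw [coord, f.mfderiv_vec hx]
  simp only [f.chart.right_inv hx]
  exact f.coframe_frame x hx a

lemma vec_mem {x : E} (hx : x ∈ f.chart.target) (a : Fin (r + 1) → ℂ) :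
    f.vec x a ∈ D.space (f.chart.symm x) := by
  rw [f.mem_iff _ (f.chart.map_target hx)]
  refine ⟨a, ?_⟩
  rw [f.mfderiv_vec hx, f.chart.right_inv hx]

lemma frame_coord {p : M} (hp : p ∈ f.chart.source) {v : TangentSpace 𝓘(ℂ, E) p}
    (hv : v ∈ D.space p) :
    f.frame (f.chart p) (f.coord p v) = mfderiv 𝓘(ℂ, E) 𝓘(ℂ, E) f.chart p v := by
  obtain ⟨a, ha⟩ := (f.mem_iff p hp v).1 hv
  rw [coord, ← ha, f.coframe_frame _ (f.chart.map_source hp)]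

lemma coord_injOn {p : M} (hp : p ∈ f.chart.source) {v w : TangentSpace 𝓘(ℂ, E) p}
    (hv : v ∈ D.space p) (hw : w ∈ D.space p) (h : f.coord p v = f.coord p w) : v = w := by
  apply f.mdiff.mfderiv_injective hp
  rw [← f.frame_coord hp hv, ← f.frame_coord hp hw, h]

lemma coord_ne_zero {p : M} (hp : p ∈ f.chart.source) {v : TangentSpace 𝓘(ℂ, E) p}
    (hv : v ∈ D.space p) (h : v ≠ 0) : f.coord p v ≠ 0 := by
  intro h0
  refine h (f.coord_injOn hp hv (D.space p).zero_mem ?_)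
  rw [h0, f.coord_zero]

/-- Change of components from one frame to another. -/
def change (x : E) : (Fin (r + 1) → ℂ) →L[ℂ] (Fin (r + 1) → ℂ) :=
  (g.coframe (g.chart (f.chart.symm x))).comp
    ((fderiv ℂ (g.chart ∘ f.chart.symm) x).comp (f.frame x))

lemma coord_vec_other {x : E} (hx : x ∈ f.chart.target) (hg : f.chart.symm x ∈ g.chart.source)
    (a : Fin (r + 1) → ℂ) : g.coord (f.chart.symm x) (f.vec x a) = f.change g x a := by
  have h := mfderiv_comp x (g.mdiff.mdifferentiableAt hg) (f.mdiff.mdifferentiableAt_symm hx)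
  rw [mfderiv_eq_fderiv] at h
  simp only [coord, change, h, vec]
  rfl

lemma contDiffOn_trans :
    ContDiffOn ℂ ω (g.chart ∘ f.chart.symm) (f.chart.symm.trans g.chart).source := by
  have h : ContMDiffOn 𝓘(ℂ, E) 𝓘(ℂ, E) ω (g.chart ∘ f.chart.symm)
      (f.chart.symm.trans g.chart).source := by
    refine (contMDiffOn_of_mem_maximalAtlas g.mem_maximalAtlas).comp
      ((contMDiffOn_symm_of_mem_maximalAtlas f.mem_maximalAtlas).mono ?_) ?_
    · intro x hx; exact hx.1
    · intro x hx; exact hx.2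
  exact h.contDiffOn

lemma contDiffOn_change :
    ContDiffOn ℂ ω (f.change g) (f.chart.symm.trans g.chart).source := by
  have ho := (f.chart.symm.trans g.chart).open_source
  have h := f.contDiffOn_trans g
  have h1 : ContDiffOn ℂ ω (fun x => g.coframe (g.chart (f.chart.symm x)))
      (f.chart.symm.trans g.chart).source :=
    g.contDiffOn_coframe.comp h (fun x hx => g.chart.map_source hx.2)
  have h2 : ContDiffOn ℂ ω (fun x => fderiv ℂ (g.chart ∘ f.chart.symm) x)
      (f.chart.symm.trans g.chart).source := h.fderiv_of_isOpen ho (by simp)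
  exact h1.clm_comp (h2.clm_comp (f.contDiffOn_frame.mono (fun x hx => hx.1)))

end FrameChart

lemma nonempty_line (D : Distribution E M r) (p : M) : Nonempty (ℙ ℂ (D.space p)) := by
  obtain ⟨f, hf⟩ := D.exists_frame p
  have hx := f.chart.map_source hf
  have hm := f.vec_mem hx (fun _ => 1)
  have hc := f.coord_vec hx (fun _ => 1)
  rw [f.chart.left_inv hf] at hm hc
  refine ⟨Projectivization.mk ℂ ⟨_, hm⟩ ?_⟩
  intro h0
  have h0' := congrArg Subtype.val h0
  simp only [ZeroMemClass.coe_zero] at h0'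
  rw [h0'] at hc
  rw [f.coord_zero] at hc
  simpa using congrFun hc 0

namespace FrameChart

variable (f g : FrameChart r D.space)

/-- Homogeneous coordinates of a line in `D`. -/
def hom (q : Prolong D) : Fin (r + 1) → ℂ := f.coord q.base (q.line.rep : TangentSpace 𝓘(ℂ, E) q.base)

open Classical in
/-- The line at the point with chart coordinates `x` spanned by the vector with components `a`. -/
def lineOf (x : E) (a : Fin (r + 1) → ℂ) : ℙ ℂ (D.space (f.chart.symm x)) :=
  if h : ∃ hm : f.vec x a ∈ D.space (f.chart.symm x),
      (⟨f.vec x a, hm⟩ : D.space (f.chart.symm x)) ≠ 0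
  then Projectivization.mk ℂ ⟨f.vec x a, h.1⟩ h.2
  else (nonempty_line D _).some

lemma exists_hom {p : M} {v : TangentSpace 𝓘(ℂ, E) p} (hv : v ∈ D.space p)
    (h0 : (⟨v, hv⟩ : D.space p) ≠ 0) :
    ∃ c : ℂ, c ≠ 0 ∧ f.hom (⟨p, Projectivization.mk ℂ ⟨v, hv⟩ h0⟩ : Prolong D) = c • f.coord p v := by
  obtain ⟨c, hc⟩ := Projectivization.exists_smul_eq_mk_rep ℂ (⟨v, hv⟩ : D.space p) h0
  refine ⟨c, c.ne_zero, ?_⟩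
  rw [hom, ← hc, ← f.coord_smul]
  rfl

lemma lineOf_eq {x : E} (hx : x ∈ f.chart.target) {a : Fin (r + 1) → ℂ} (ha : a ≠ 0) :
    ∃ h : (⟨f.vec x a, f.vec_mem hx a⟩ : D.space (f.chart.symm x)) ≠ 0,
      f.lineOf x a = Projectivization.mk ℂ ⟨f.vec x a, f.vec_mem hx a⟩ h := by
  have h : (⟨f.vec x a, f.vec_mem hx a⟩ : D.space (f.chart.symm x)) ≠ 0 := by
    intro h0
    have h0' := congrArg Subtype.val h0
    simp only [ZeroMemClass.coe_zero] at h0'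
    have hc := f.coord_vec hx a
    rw [h0'] at hc
    apply ha
    rw [← hc, f.coord_zero]
  refine ⟨h, ?_⟩
  rw [lineOf, dif_pos ⟨f.vec_mem hx a, h⟩]

lemma insertNth_ne_zero (i : Fin (r + 1)) (u : Fin r → ℂ) :
    (i.insertNth (1 : ℂ) u : Fin (r + 1) → ℂ) ≠ 0 := by
  intro h
  have := congrFun h i
  simp at this

lemma exists_hom_lineOf {x : E} (hx : x ∈ f.chart.target) (hg : f.chart.symm x ∈ g.chart.source)
    {a : Fin (r + 1) → ℂ} (ha : a ≠ 0) :
    ∃ c : ℂ, c ≠ 0 ∧ g.hom (⟨f.chart.symm x, f.lineOf x a⟩ : Prolong D) = c • f.change g x a := by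
  obtain ⟨h, e⟩ := f.lineOf_eq hx ha
  rw [e]
  obtain ⟨c, hc, h2⟩ := g.exists_hom (f.vec_mem hx a) h
  exact ⟨c, hc, by rw [h2, f.coord_vec_other g hx hg]⟩

lemma exists_hom_lineOf_self {x : E} (hx : x ∈ f.chart.target)
    {a : Fin (r + 1) → ℂ} (ha : a ≠ 0) :
    ∃ c : ℂ, c ≠ 0 ∧ f.hom (⟨f.chart.symm x, f.lineOf x a⟩ : Prolong D) = c • a := by
  obtain ⟨h, e⟩ := f.lineOf_eq hx ha
  rw [e]
  obtain ⟨c, hc, h2⟩ := f.exists_hom (f.vec_mem hx a) h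
  exact ⟨c, hc, by rw [h2, f.coord_vec hx]⟩

lemma eq_of_hom {q q' : Prolong D} (hq : q.base ∈ f.chart.source) (hb : q.base = q'.base)
    {c : ℂ} (h : f.hom q = c • f.hom q') : q = q' := by
  obtain ⟨p, l⟩ := q
  obtain ⟨p', l'⟩ := q'
  obtain rfl : p = p' := hb
  congr 1
  rw [← l.mk_rep, ← l'.mk_rep, Projectivization.mk_eq_mk_iff']
  refine ⟨c, ?_⟩
  apply Subtype.ext
  refine (f.coord_injOn hq l.rep.2 (D.space p |>.smul_mem c l'.rep.2) ?_).symm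
  rw [f.coord_smul]
  exact h

/-- The affine chart of `ℙD` attached to a framed chart of `M`, on the set of the lines whose
`i`-th homogeneous coordinate does not vanish. -/
def affineChart (i : Fin (r + 1)) : PartialEquiv (Prolong D) (E × (Fin r → ℂ)) where
  toFun q := (f.chart q.base, fun j => f.hom q (i.succAbove j) / f.hom q i)
  invFun y := ⟨f.chart.symm y.1, f.lineOf y.1 (i.insertNth (1 : ℂ) y.2)⟩
  source := {q | q.base ∈ f.chart.source ∧ f.hom q i ≠ 0}
  target := {y | y.1 ∈ f.chart.target}
  map_source' q hq := f.chart.map_source hq.1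
  map_target' y hy := by
    refine ⟨f.chart.map_target hy, ?_⟩
    obtain ⟨c, hc, h⟩ := f.exists_hom_lineOf_self hy (insertNth_ne_zero i y.2)
    rw [h]
    simpa using hc
  left_inv' q hq := by
    have hx := f.chart.map_source hq.1
    obtain ⟨c, hc, h⟩ := f.exists_hom_lineOf_self hx
      (insertNth_ne_zero i (fun j => f.hom q (i.succAbove j) / f.hom q i))
    refine f.eq_of_hom (c := c / f.hom q i) (f.chart.map_target hx) (f.chart.left_inv hq.1) ?_
    rw [h]
    have hqi := hq.2
    ext j
    refine Fin.succAboveCases i ?_ (fun j => ?_) j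
    · simp; field_simp
    · simp; field_simp
  right_inv' y hy := by
    obtain ⟨c, hc, h⟩ := f.exists_hom_lineOf_self hy (insertNth_ne_zero i y.2)
    refine Prod.ext (f.chart.right_inv hy) ?_
    funext j
    simp only [h]
    simp [hc]

lemma trans_source (i k : Fin (r + 1)) :
    ((f.affineChart i).symm.trans (g.affineChart k)).source =
      {y | y.1 ∈ (f.chart.symm.trans g.chart).source ∧
        f.change g y.1 (i.insertNth (1 : ℂ) y.2) k ≠ 0} := by
  ext y
  constructor
  · rintro ⟨h1, h2, h3⟩
    obtain ⟨c, hc, h⟩ := f.exists_hom_lineOf g h1 h2 (insertNth_ne_zero i y.2)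
    refine ⟨⟨h1, h2⟩, fun h0 => h3 ?_⟩
    change g.hom ⟨_, _⟩ k = 0
    rw [h]; simp [h0]
  · rintro ⟨⟨h1, h2⟩, h3⟩
    obtain ⟨c, hc, h⟩ := f.exists_hom_lineOf g h1 h2 (insertNth_ne_zero i y.2)
    refine ⟨h1, h2, ?_⟩
    change g.hom ⟨_, _⟩ k ≠ 0
    rw [h]
    simpa using ⟨hc, h3⟩

lemma trans_eqOn (i k : Fin (r + 1)) :
    EqOn ((f.affineChart i).symm.trans (g.affineChart k))
      (fun y => (g.chart (f.chart.symm y.1), fun j =>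
        f.change g y.1 (i.insertNth (1 : ℂ) y.2) (k.succAbove j) /
          f.change g y.1 (i.insertNth (1 : ℂ) y.2) k))
      ((f.affineChart i).symm.trans (g.affineChart k)).source := by
  rintro y ⟨h1, h2, h3⟩
  obtain ⟨c, hc, h⟩ := f.exists_hom_lineOf g h1 h2 (insertNth_ne_zero i y.2)
  refine Prod.ext rfl ?_
  funext j
  change g.hom ⟨_, _⟩ _ / g.hom ⟨_, _⟩ _ = _
  rw [h]
  simp only [Pi.smul_apply, smul_eq_mul]
  rw [mul_div_mul_left _ _ hc]

lemma contDiff_insertNth (i : Fin (r + 1)) :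
    ContDiff ℂ ω (fun u : Fin r → ℂ => (i.insertNth (1 : ℂ) u : Fin (r + 1) → ℂ)) := by
  rw [contDiff_pi]
  intro j
  refine Fin.succAboveCases i ?_ (fun j => ?_) j
  · simpa using contDiff_const
  · simpa using contDiff_apply ℂ ℂ j

lemma contDiffOn_comp (i : Fin (r + 1)) (k : Fin (r + 1)) :
    ContDiffOn ℂ ω (fun y : E × (Fin r → ℂ) => f.change g y.1 (i.insertNth (1 : ℂ) y.2) k)
      {y | y.1 ∈ (f.chart.symm.trans g.chart).source} := by
  have h1 : ContDiffOn ℂ ω (fun y : E × (Fin r → ℂ) => f.change g y.1)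
      {y | y.1 ∈ (f.chart.symm.trans g.chart).source} :=
    (f.contDiffOn_change g).comp contDiff_fst.contDiffOn (fun y hy => hy)
  have h2 := h1.clm_apply ((contDiff_insertNth i).comp contDiff_snd).contDiffOn
  exact contDiffOn_pi.1 h2 k

lemma isOpen_trans_source (i k : Fin (r + 1)) :
    IsOpen ((f.affineChart i).symm.trans (g.affineChart k)).source := by
  rw [trans_source]
  have ho : IsOpen {y : E × (Fin r → ℂ) | y.1 ∈ (f.chart.symm.trans g.chart).source} :=
    (f.chart.symm.trans g.chart).open_source.preimage continuous_fst
  exact (f.contDiffOn_comp g i k).continuousOn.isOpen_inter_preimage ho isOpen_ne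

lemma contDiffOn_affine_trans (i k : Fin (r + 1)) :
    ContDiffOn ℂ ω ((f.affineChart i).symm.trans (g.affineChart k))
      ((f.affineChart i).symm.trans (g.affineChart k)).source := by
  refine ContDiffOn.congr ?_ (f.trans_eqOn g i k)
  rw [trans_source]
  refine ContDiffOn.prodMk ?_ (contDiffOn_pi.2 fun j => ?_)
  · exact (f.contDiffOn_trans g).comp contDiff_fst.contDiffOn (fun y hy => hy.1)
  · exact ((f.contDiffOn_comp g i _).mono (fun y hy => hy.1)).div
      ((f.contDiffOn_comp g i k).mono (fun y hy => hy.1)) (fun y hy => hy.2)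

end FrameChart

lemma exists_affineChart (q : Prolong D) :
    ∃ (f : FrameChart r D.space) (i : Fin (r + 1)), q ∈ (f.affineChart i).source := by
  obtain ⟨f, hf⟩ := D.exists_frame q.base
  have h : f.hom q ≠ 0 := f.coord_ne_zero hf q.line.rep.2 (by
    intro h0
    exact q.line.rep_nonzero (Subtype.ext h0))
  obtain ⟨i, hi⟩ := Function.ne_iff.1 h
  exact ⟨f, i, hf, hi⟩

variable (D) in
/-- The affine charts form an atlas of `ℙD`. -/
def prolongCore : ChartedSpaceCore (E × (Fin r → ℂ)) (Prolong D) where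
  atlas := {e | ∃ (f : FrameChart r D.space) (i : Fin (r + 1)), e = f.affineChart i}
  chartAt q := (exists_affineChart q).choose.affineChart (exists_affineChart q).choose_spec.choose
  mem_chart_source q := (exists_affineChart q).choose_spec.choose_spec
  chart_mem_atlas q := ⟨_, _, rfl⟩
  open_source := by
    rintro _ _ ⟨f, i, rfl⟩ ⟨g, k, rfl⟩
    exact f.isOpen_trans_source g i k
  continuousOn_toFun := by
    rintro _ _ ⟨f, i, rfl⟩ ⟨g, k, rfl⟩
    exact (f.contDiffOn_affine_trans g i k).continuousOn

instance : TopologicalSpace (Prolong D) := (prolongCore D).toTopologicalSpace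

instance : ChartedSpace (E × (Fin r → ℂ)) (Prolong D) := (prolongCore D).toChartedSpace

instance : IsManifold 𝓘(ℂ, E × (Fin r → ℂ)) ω (Prolong D) := by
  refine isManifold_of_contDiffOn _ _ _ ?_
  intro e e' he he'
  obtain ⟨e, ⟨f, i, rfl⟩, rfl⟩ : ∃ (c : PartialEquiv _ _) (h : c ∈ (prolongCore D).atlas),
      e = (prolongCore D).openPartialHomeomorph c h := by
    simpa [atlas, ChartedSpace.atlas] using! he
  obtain ⟨e', ⟨g, k, rfl⟩, rfl⟩ : ∃ (c : PartialEquiv _ _) (h : c ∈ (prolongCore D).atlas),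
      e' = (prolongCore D).openPartialHomeomorph c h := by
    simpa [atlas, ChartedSpace.atlas] using! he'
  simpa using! f.contDiffOn_affine_trans g i k

section

/-- The line `ℓ` of a point `(z, ℓ)` of `ℙD`, as a subspace of the tangent space at `z`. -/
def Prolong.lineSpace (q : Prolong D) : Submodule ℂ (TangentSpace 𝓘(ℂ, E) q.base) :=
  q.line.submodule.map (D.space q.base).subtype

variable (D)

/-- The prolonged distribution `D¹ (z, ℓ) = (dπ)⁻¹ ℓ`, where `π : ℙD → M` is `Prolong.base`. -/
def prolongSpace (q : Prolong D) : Submodule ℂ (TangentSpace 𝓘(ℂ, E × (Fin r → ℂ)) q) :=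
  q.lineSpace.comap
    (mfderiv 𝓘(ℂ, E × (Fin r → ℂ)) 𝓘(ℂ, E) (Prolong.base (D := D)) q).toLinearMap

end

namespace FrameChart

variable (f : FrameChart r D.space)

/-- The affine chart as an open partial homeomorphism. -/
def affineHomeo (i : Fin (r + 1)) : OpenPartialHomeomorph (Prolong D) (E × (Fin r → ℂ)) :=
  (prolongCore D).openPartialHomeomorph (f.affineChart i) ⟨f, i, rfl⟩

lemma affineHomeo_mem (i : Fin (r + 1)) :
    f.affineHomeo i ∈ IsManifold.maximalAtlas 𝓘(ℂ, E × (Fin r → ℂ)) ω (Prolong D) := by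
  apply IsManifold.subset_maximalAtlas
  simp only [atlas, ChartedSpace.atlas]
  exact mem_iUnion₂.2 ⟨f.affineChart i, ⟨f, i, rfl⟩, rfl⟩

lemma mdiff_affineHomeo (i : Fin (r + 1)) : (f.affineHomeo i).MDifferentiable
    𝓘(ℂ, E × (Fin r → ℂ)) 𝓘(ℂ, E × (Fin r → ℂ)) :=
  ⟨(contMDiffOn_of_mem_maximalAtlas (f.affineHomeo_mem i)).mdifferentiableOn (by simp),
    (contMDiffOn_symm_of_mem_maximalAtlas (f.affineHomeo_mem i)).mdifferentiableOn (by simp)⟩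

lemma mdifferentiableAt_proj (i : Fin (r + 1)) {q : Prolong D}
    (hq : q ∈ (f.affineChart i).source) :
    MDifferentiableAt 𝓘(ℂ, E × (Fin r → ℂ)) 𝓘(ℂ, E) (Prolong.base (D := D)) q := by
  have h1 : MDifferentiableAt 𝓘(ℂ, E × (Fin r → ℂ)) 𝓘(ℂ, E)
      (f.chart.symm ∘ (Prod.fst ∘ f.affineHomeo i)) q := by
    refine MDifferentiableAt.comp q (I' := 𝓘(ℂ, E))
      (f.mdiff.mdifferentiableAt_symm (f.chart.map_source hq.1)) ?_
    exact MDifferentiableAt.comp q (I' := 𝓘(ℂ, E × (Fin r → ℂ)))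
      differentiable_fst.mdifferentiable.mdifferentiableAt
      ((f.mdiff_affineHomeo i).mdifferentiableAt hq)
  refine h1.congr_of_eventuallyEq ?_
  filter_upwards [(f.affineHomeo i).open_source.mem_nhds hq] with q' hq'
  exact (f.chart.left_inv hq'.1).symm

lemma mfderiv_proj (i : Fin (r + 1)) {q : Prolong D} (hq : q ∈ (f.affineChart i).source)
    (w : TangentSpace 𝓘(ℂ, E × (Fin r → ℂ)) q) :
    mfderiv 𝓘(ℂ, E) 𝓘(ℂ, E) f.chart q.base
        (mfderiv 𝓘(ℂ, E × (Fin r → ℂ)) 𝓘(ℂ, E) (Prolong.base (D := D)) q w) =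
      (mfderiv 𝓘(ℂ, E × (Fin r → ℂ)) 𝓘(ℂ, E × (Fin r → ℂ)) (f.affineHomeo i) q w :
        E × (Fin r → ℂ)).1 := by
  have h1 := mfderiv_comp (I' := 𝓘(ℂ, E)) q (f.mdiff.mdifferentiableAt hq.1)
    (f.mdifferentiableAt_proj i hq)
  have h2 := mfderiv_comp (I'' := 𝓘(ℂ, E)) (g := (Prod.fst : E × (Fin r → ℂ) → E)) q
    (I' := 𝓘(ℂ, E × (Fin r → ℂ)))
    differentiable_fst.mdifferentiable.mdifferentiableAt
    ((f.mdiff_affineHomeo i).mdifferentiableAt hq)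
  rw [mfderiv_eq_fderiv, fderiv_fst] at h2
  have h3 : f.chart ∘ Prolong.base (D := D) = Prod.fst ∘ f.affineHomeo i := rfl
  rw [h3, h2] at h1
  exact (DFunLike.congr_fun h1 w).symm

/-- Frame of the prolonged distribution: the lift of the tautological direction, and the
coordinate directions of the fiber. -/
def prolongFrame (i : Fin (r + 1)) (y : E × (Fin r → ℂ)) :
    (Fin (r + 1) → ℂ) →L[ℂ] E × (Fin r → ℂ) :=
  ((ContinuousLinearMap.proj 0 : (Fin (r + 1) → ℂ) →L[ℂ] ℂ).smulRight
      (f.frame y.1 (i.insertNth (1 : ℂ) y.2))).prod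
    (ContinuousLinearMap.pi fun j => ContinuousLinearMap.proj j.succ)

/-- The dual coframe. -/
def prolongCoframe (i : Fin (r + 1)) (y : E × (Fin r → ℂ)) :
    E × (Fin r → ℂ) →L[ℂ] (Fin (r + 1) → ℂ) :=
  ContinuousLinearMap.pi (Fin.cases
    ((ContinuousLinearMap.proj i).comp ((f.coframe y.1).comp (ContinuousLinearMap.fst ℂ _ _)))
    (fun j => (ContinuousLinearMap.proj j).comp (ContinuousLinearMap.snd ℂ _ _)))

lemma prolong_mem_iff (i : Fin (r + 1)) {q : Prolong D} (hq : q ∈ (f.affineChart i).source)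
    (w : TangentSpace 𝓘(ℂ, E × (Fin r → ℂ)) q) :
    w ∈ prolongSpace D q ↔ ∃ a, f.prolongFrame i (f.affineHomeo i q) a =
      mfderiv 𝓘(ℂ, E × (Fin r → ℂ)) 𝓘(ℂ, E × (Fin r → ℂ)) (f.affineHomeo i) q w := by
  have hi : f.hom q i ≠ 0 := hq.2
  have hrep : mfderiv 𝓘(ℂ, E) 𝓘(ℂ, E) f.chart q.base (q.line.rep : TangentSpace 𝓘(ℂ, E) q.base)
      = f.hom q i • f.frame (f.chart q.base)
        (i.insertNth (1 : ℂ) (fun j => f.hom q (i.succAbove j) / f.hom q i)) := by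
    rw [← f.frame_coord hq.1 q.line.rep.2, ← map_smul]
    congr 1
    change f.hom q = _
    ext j
    refine Fin.succAboveCases i ?_ (fun j => ?_) j
    · simp
    · simp; field_simp
  have h1 : w ∈ prolongSpace D q ↔ ∃ c : ℂ, c • (q.line.rep : TangentSpace 𝓘(ℂ, E) q.base) =
      mfderiv 𝓘(ℂ, E × (Fin r → ℂ)) 𝓘(ℂ, E) (Prolong.base (D := D)) q w := by
    rw [prolongSpace, Submodule.mem_comap, Prolong.lineSpace, Submodule.mem_map]
    constructor
    · rintro ⟨v, hv, e⟩
      rw [q.line.submodule_eq, Submodule.mem_span_singleton] at hv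
      obtain ⟨c, rfl⟩ := hv
      exact ⟨c, e⟩
    · rintro ⟨c, hc⟩
      refine ⟨c • q.line.rep, ?_, hc⟩
      rw [q.line.submodule_eq]
      exact Submodule.smul_mem _ _ (Submodule.mem_span_singleton_self _)
  rw [h1]
  have hm := f.mfderiv_proj i hq w
  constructor
  · rintro ⟨c, hc⟩
    rw [← hc, ContinuousLinearMap.map_smul, hrep] at hm
    refine ⟨Fin.cons (c * f.hom q i) (mfderiv 𝓘(ℂ, E × (Fin r → ℂ)) 𝓘(ℂ, E × (Fin r → ℂ))
      (f.affineHomeo i) q w : E × (Fin r → ℂ)).2, ?_⟩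
    refine Prod.ext ?_ ?_
    · exact Eq.trans (smul_smul (α := E) c (f.hom q i) _).symm hm
    · funext j
      rfl
  · rintro ⟨a, ha⟩
    refine ⟨a 0 / f.hom q i, ?_⟩
    apply f.mdiff.mfderiv_injective hq.1
    refine Eq.trans ?_ hm.symm
    rw [← ha, ContinuousLinearMap.map_smul, hrep]
    refine Eq.trans (smul_smul (α := E) (a 0 / f.hom q i) (f.hom q i) _) ?_
    rw [div_mul_cancel₀ _ hi]
    rfl

/-- The affine chart with the frame of the prolonged distribution. -/
def prolongChart (i : Fin (r + 1)) : FrameChart r (prolongSpace D) where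
  chart := f.affineHomeo i
  frame := f.prolongFrame i
  coframe := f.prolongCoframe i
  mem_maximalAtlas := f.affineHomeo_mem i
  contDiffOn_frame := by
    have h : ContDiffOn ℂ ω (fun y : E × (Fin r → ℂ) => f.frame y.1 (i.insertNth (1 : ℂ) y.2))
        (f.affineHomeo i).target :=
      (f.contDiffOn_frame.comp contDiff_fst.contDiffOn (fun y hy => hy)).clm_apply
        ((contDiff_insertNth i).comp contDiff_snd).contDiffOn
    have h2 : ContDiffOn ℂ ω (fun y : E × (Fin r → ℂ) =>
        (ContinuousLinearMap.proj 0 : (Fin (r + 1) → ℂ) →L[ℂ] ℂ).smulRight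
          (f.frame y.1 (i.insertNth (1 : ℂ) y.2))) (f.affineHomeo i).target :=
      contDiffOn_const.smulRight h
    have h3 := (ContinuousLinearMap.compL ℂ (Fin (r + 1) → ℂ) E (E × (Fin r → ℂ))
      (ContinuousLinearMap.inl ℂ E (Fin r → ℂ))).contDiff.comp_contDiffOn h2
    refine (h3.add (contDiffOn_const (c := (ContinuousLinearMap.inr ℂ E (Fin r → ℂ)).comp
      (ContinuousLinearMap.pi fun j => ContinuousLinearMap.proj j.succ)))).congr ?_
    intro y _
    ext a <;> simp [prolongFrame]
  contDiffOn_coframe := by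
    have h : ContDiffOn ℂ ω (fun y : E × (Fin r → ℂ) => f.coframe y.1)
        (f.affineHomeo i).target :=
      f.contDiffOn_coframe.comp contDiff_fst.contDiffOn (fun y hy => hy)
    have h1 : ContDiffOn ℂ ω (fun y : E × (Fin r → ℂ) =>
        ((ContinuousLinearMap.single ℂ (fun _ : Fin (r + 1) => ℂ) 0).comp
          (ContinuousLinearMap.proj i)).comp ((f.coframe y.1).comp
            (ContinuousLinearMap.fst ℂ E (Fin r → ℂ)))) (f.affineHomeo i).target :=
      contDiffOn_const.clm_comp (h.clm_comp contDiffOn_const)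
    refine (h1.add (contDiffOn_const (c := (ContinuousLinearMap.pi
      (Fin.cases 0 fun j => ContinuousLinearMap.proj j)).comp
        (ContinuousLinearMap.snd ℂ E (Fin r → ℂ))))).congr ?_
    intro y _
    ext a j <;> refine Fin.cases ?_ (fun j => ?_) j <;> simp [prolongCoframe]
  coframe_frame := by
    intro y hy a
    funext j
    refine Fin.cases ?_ (fun j => ?_) j
    · simp [prolongCoframe, prolongFrame, f.coframe_frame y.1 hy]
    · simp [prolongCoframe, prolongFrame]
  mem_iff := fun q hq w => f.prolong_mem_iff i hq w

end FrameChart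

variable (D) in
/-- The prolongation of a distribution. -/
def Distribution.prolong : Distribution (E × (Fin r → ℂ)) (Prolong D) r where
  space := prolongSpace D
  exists_frame q := by
    obtain ⟨f, i, h⟩ := exists_affineChart q
    exact ⟨f.prolongChart i, h⟩

/-- The velocity of a curve. -/
def velocity (c : ℂ → M) (t : ℂ) : TangentSpace 𝓘(ℂ, E) (c t) :=
  mfderiv 𝓘(ℂ, ℂ) 𝓘(ℂ, E) c t (1 : ℂ)

/-- The germ at `0` of the curve `C` in `ℙD` is the prolongation of the germ at `0` of the curve `c`
in `M`: near `0` the regular points of `c` are sent to `(c t, span (dc/dt))`, and the value at `0`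
is the limit, because `C` is analytic at `0`. -/
def IsCurveProlong (D : Distribution E M r) (c : ℂ → M) (C : ℂ → Prolong D) : Prop :=
  ContMDiffAt 𝓘(ℂ, ℂ) 𝓘(ℂ, E × (Fin r → ℂ)) ω C 0 ∧
    ∀ᶠ t in 𝓝[≠] (0 : ℂ), ∃ (h : velocity (E := E) c t ∈ D.space (c t))
      (h0 : (⟨velocity (E := E) c t, h⟩ : D.space (c t)) ≠ 0),
      C t = ⟨c t, Projectivization.mk ℂ ⟨velocity (E := E) c t, h⟩ h0⟩

open Classical in
/-- The prolongation `φ¹ (z, ℓ) = (φ z, dφ_z ℓ)` of a symmetry `φ`. At points where the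
differential of `φ` does not map the distribution injectively into itself, which do not occur for
local symmetries of the distribution, the value is irrelevant. -/
def prolongMap (D : Distribution E M r) (φ : M → M) (q : Prolong D) : Prolong D :=
  if h : ∃ h1 : ∀ v ∈ D.space q.base,
      (mfderiv 𝓘(ℂ, E) 𝓘(ℂ, E) φ q.base).toLinearMap v ∈ D.space (φ q.base),
      Function.Injective
        ((mfderiv 𝓘(ℂ, E) 𝓘(ℂ, E) φ q.base).toLinearMap.restrict h1)
  then ⟨φ q.base, Projectivization.map _ h.2 q.line⟩
  else q

/-- The tangent vectors at `q` to a submanifold `S`: the velocities of the analytic curve germs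
through `q` that stay in `S`. -/
def tangentSet (S : Set M) (q : M) : Set (TangentSpace 𝓘(ℂ, E) q) :=
  {v | ∃ c : ℂ → M, ∃ h : c 0 = q, ContMDiffAt 𝓘(ℂ, ℂ) 𝓘(ℂ, E) ω c 0 ∧
    (∀ᶠ t in 𝓝 (0 : ℂ), c t ∈ S) ∧ h ▸ velocity (E := E) c 0 = v}

/-- A (complex analytic, possibly empty and possibly singular) hypersurface: locally the zero set
of one analytic function that does not vanish identically on any nonempty open set. -/
def IsHypersurface (E : Type) [NormedAddCommGroup E] [NormedSpace ℂ E]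
    {M : Type} [TopologicalSpace M] [ChartedSpace E M] (S : Set M) : Prop :=
  ∀ p : M, ∃ (U : Set M) (f : M → ℂ), IsOpen U ∧ p ∈ U ∧ ContMDiffOn 𝓘(ℂ, E) 𝓘(ℂ, ℂ) ω f U ∧
    (∀ V ⊆ U, IsOpen V → V.Nonempty → ∃ x ∈ V, f x ≠ 0) ∧ S ∩ U = {x ∈ U | f x = 0}

end Prolongation

/-! The tower. -/

/-- A complex manifold with an analytic distribution of rank `r + 1`. -/
structure DistManifold (r : ℕ) : Type 1 where
  Model : Type
  [normedGroup : NormedAddCommGroup Model]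
  [normedSpace : NormedSpace ℂ Model]
  Pt : Type
  [topology : TopologicalSpace Pt]
  [charted : ChartedSpace Model Pt]
  [manifold : IsManifold 𝓘(ℂ, Model) ω Pt]
  dist : Distribution Model Pt r

attribute [instance] DistManifold.normedGroup DistManifold.normedSpace DistManifold.topology
  DistManifold.charted DistManifold.manifold

/-- The tangent bundle of a vector space as a distribution. -/
def flat (r : ℕ) : Distribution (Fin (r + 1) → ℂ) (Fin (r + 1) → ℂ) r where
  space _ := ⊤
  exists_frame _ := ⟨
    { chart := OpenPartialHomeomorph.refl _
      frame := fun _ => ContinuousLinearMap.id ℂ _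
      coframe := fun _ => ContinuousLinearMap.id ℂ _
      mem_maximalAtlas := IsManifold.subset_maximalAtlas (by simp)
      contDiffOn_frame := contDiffOn_const
      contDiffOn_coframe := contDiffOn_const
      coframe_frame := fun _ _ _ => rfl
      mem_iff := fun _ _ _ => ⟨fun _ => ⟨_, rfl⟩, fun _ => Submodule.mem_top⟩ }, mem_univ _⟩

/-- The Monster tower `(𝒫^k(n), Δ_k)` for curves in `ℂⁿ`, with `n = r + 1`. -/
def tower (r : ℕ) : ℕ → DistManifold r
  | 0 => { Model := Fin (r + 1) → ℂ, Pt := Fin (r + 1) → ℂ, dist := flat r }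
  | k + 1 =>
    { Model := (tower r k).Model × (Fin r → ℂ)
      Pt := Prolong (tower r k).dist
      dist := (tower r k).dist.prolong }

/-- The manifold `𝒫^k(r + 1)`. -/
abbrev P (r k : ℕ) : Type := (tower r k).Pt

/-- The vector space on which `𝒫^k(r + 1)` is modelled. -/
abbrev Model (r k : ℕ) : Type := (tower r k).Model

/-- The distribution `Δ_k`. -/
def Δ (r k : ℕ) (p : P r k) : Submodule ℂ (TangentSpace 𝓘(ℂ, Model r k) p) :=
  (tower r k).dist.space p

variable {r : ℕ}

/-- The bundle projection `π_{k+1,k}`. -/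
def down {k : ℕ} (q : P r (k + 1)) : P r k :=
  Prolong.base (D := (tower r k).dist) q

/-- The line `ℓ ⊆ Δ_k(z)` of a point `(z, ℓ)` of level `k + 1`. -/
def lineAt {k : ℕ} (q : P r (k + 1)) : Submodule ℂ (TangentSpace 𝓘(ℂ, Model r k) (down q)) :=
  Prolong.lineSpace (D := (tower r k).dist) q

/-- The projection `π_{k,i}`. -/
def proj {i k : ℕ} (h : i ≤ k) : P r k → P r i :=
  Nat.leRecOn (C := fun j => P r j → P r i) h (fun g q => g (down q)) id

/-- The germ at `0` of `Γ` is the `k`-th prolongation of the analytic curve germ `γ` in `ℂⁿ`. -/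
def IsProlongation (γ : ℂ → P r 0) : (k : ℕ) → (ℂ → P r k) → Prop
  | 0, Γ => Γ = γ ∧ ContMDiffAt 𝓘(ℂ, ℂ) 𝓘(ℂ, Model r 0) ω γ 0
  | k + 1, Γ => ∃ Γ' : ℂ → P r k, IsProlongation γ k Γ' ∧ IsCurveProlong (tower r k).dist Γ' Γ

/-- The curve germ `γ` realizes the point `p`: `γ^k(0) = p` and `γ^k` is immersed. -/
def Realizes {k : ℕ} (γ : ℂ → P r 0) (p : P r k) : Prop :=
  ∃ Γ : ℂ → P r k, IsProlongation γ k Γ ∧ Γ 0 = p ∧ velocity (E := Model r k) Γ 0 ≠ 0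

/-- Cartan points: those realized by an immersed curve germ in `ℂⁿ`. -/
def IsCartan {k : ℕ} (p : P r k) : Prop :=
  ∃ γ : ℂ → P r 0, velocity (E := Model r 0) γ 0 ≠ 0 ∧ Realizes γ p

/-- The set `C^k(n)` of the Cartan points. -/
def cartanSet (r k : ℕ) : Set (P r k) := {p | IsCartan p}

/-- The `k`-th prolongation of a (local) diffeomorphism of `ℂⁿ`. -/
def prolongDiffeo (ψ : P r 0 → P r 0) : (k : ℕ) → P r k → P r k
  | 0 => ψ
  | k + 1 => prolongMap (tower r k).dist (prolongDiffeo ψ k)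

/-- Equivalence of points under the pseudogroup of local analytic diffeomorphisms of `ℂⁿ`. -/
def Equivalent {k : ℕ} (p q : P r k) : Prop :=
  ∃ ψ : OpenPartialHomeomorph (P r 0) (P r 0),
    ContMDiffOn 𝓘(ℂ, Model r 0) 𝓘(ℂ, Model r 0) ω ψ ψ.source ∧
    ContMDiffOn 𝓘(ℂ, Model r 0) 𝓘(ℂ, Model r 0) ω ψ.symm ψ.target ∧
    proj (Nat.zero_le k) p ∈ ψ.source ∧ prolongDiffeo ψ k p = q

/-- The vertical space `V_{k+1}(q)`, the kernel of `dπ_{k+1,k}` at `q`. -/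
def verticalSpace {k : ℕ} (q : P r (k + 1)) :
    Submodule ℂ (TangentSpace 𝓘(ℂ, Model r (k + 1)) q) :=
  (mfderiv 𝓘(ℂ, Model r (k + 1)) 𝓘(ℂ, Model r k) (down (r := r) (k := k)) q).ker

/-- Vertical points: `p = (p_{k-1}, ℓ)` with `k > 1` and `ℓ` vertical. -/
def IsVertical : {k : ℕ} → P r k → Prop
  | 0, _ => False
  | 1, _ => False
  | _ + 2, p => lineAt p ≤ verticalSpace (down p)

/-- The submanifolds `𝒫^j(F) ⊆ 𝒫^{i+j}(n)` (baby monsters), where `F` is a fiber of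
`𝒫^i(n) → 𝒫^{i-1}(n)`. The prolongation of such a submanifold `S` consists of the pairs `(q, ℓ)`
with `q ∈ S` and `ℓ ⊆ Δ(q) ∩ T_q S`. -/
inductive IsBabyMonster (r : ℕ) : (k : ℕ) → Set (P r k) → Prop
  | fiber (k : ℕ) (b : P r k) : IsBabyMonster r (k + 1) {q | down q = b}
  | prolong (k : ℕ) (S : Set (P r k)) : IsBabyMonster r k S →
      IsBabyMonster r (k + 1)
        {q | down q ∈ S ∧ ∀ v ∈ lineAt q, v ∈ tangentSet (E := Model r k) S (down q)}

/-- Critical points: `p = (q, ℓ)` with `ℓ` contained in a critical hyperplane `Δ(q) ∩ T_q S`, where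
`S` is a baby monster through `q`. -/
def IsCritical : {k : ℕ} → P r k → Prop
  | 0, _ => False
  | k + 1, p => ∃ S : Set (P r k), IsBabyMonster r k S ∧ down p ∈ S ∧
      ∀ v ∈ lineAt p, v ∈ tangentSet (E := Model r k) S (down p)

/-- The letters of the RVT code. -/
inductive Letter
  | R
  | V
  | T

open Classical in
/-- The letter of a point: `V` for vertical points, `T` for the other critical points, and `R` for
regular points. -/
def letter {k : ℕ} (p : P r k) : Letter :=
  if IsVertical p then Letter.V else if IsCritical p then Letter.T else Letter.R

/-- The RVT code `w_1 … w_k` of a point of level `k`; its letter number `i + 1` is the letter of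
`p_{i+1}`. -/
def code {k : ℕ} (p : P r k) : Fin k → Letter :=
  fun i => letter (proj (Nat.succ_le_of_lt i.isLt) p)

/-- The space `J^k(ℂ, ℂ^r)` of `k`-jets of analytic maps, with the coordinates `(x, u_0, …, u_k)`,
where `u_j` is the `j`-th derivative. -/
abbrev JetSpace (r k : ℕ) : Type := ℂ × (Fin (k + 1) → Fin r → ℂ)

/-- The canonical distribution on `J^k(ℂ, ℂ^r)`, given by the Pfaffian equations
`du_j = u_{j+1} dx` for `0 ≤ j < k`. -/
def jetDistribution (r k : ℕ) (z : JetSpace r k) :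
    Submodule ℂ (TangentSpace 𝓘(ℂ, JetSpace r k) z) where
  carrier := {w : JetSpace r k | ∀ j : Fin k, w.2 j.castSucc = w.1 • z.2 j.succ}
  add_mem' {v w} hv hw j := by
    change (v : JetSpace r k).2 _ + (w : JetSpace r k).2 _ =
      ((v : JetSpace r k).1 + (w : JetSpace r k).1) • _
    rw [hv j, hw j, add_smul]
  zero_mem' j := (zero_smul ℂ (z.2 j.succ)).symm
  smul_mem' c w hw j := by
    change c • (w : JetSpace r k).2 _ = (c • (w : JetSpace r k).1) • _
    rw [hw j, smul_assoc]

/-- Near `p` the pair `(𝒫^k(r + 1), Δ_k)` is analytically diffeomorphic to an open part of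
`J^k(ℂ, ℂ^r)` with its canonical distribution. -/
def IsLocallyJet {k : ℕ} (p : P r k) : Prop :=
  ∃ Φ : OpenPartialHomeomorph (P r k) (JetSpace r k), p ∈ Φ.source ∧
    ContMDiffOn 𝓘(ℂ, Model r k) 𝓘(ℂ, JetSpace r k) ω Φ Φ.source ∧
    ContMDiffOn 𝓘(ℂ, JetSpace r k) 𝓘(ℂ, Model r k) ω Φ.symm Φ.target ∧
    ∀ q ∈ Φ.source, ∀ v : TangentSpace 𝓘(ℂ, Model r k) q,
      v ∈ Δ r k q ↔
        mfderiv 𝓘(ℂ, Model r k) 𝓘(ℂ, JetSpace r k) Φ q v ∈ jetDistribution r k (Φ q)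

end Monster

end

noncomputable section

namespace Monster

section General

variable {E : Type} [NormedAddCommGroup E] [NormedSpace ℂ E]
  {M : Type} [TopologicalSpace M] [ChartedSpace E M] {r : ℕ} {D : Distribution E M r}

/-! ### The projection and the topology of the prolongation -/

/-! Throughout n = r + 1. The Cartan points are exactly the points with no vertical projection, and
these are exactly the points covered by n charts of the tower, the jet charts, one for each
coordinate of ℂⁿ taken as independent variable x.

The jet charts arise by iterating the affine chart of index 0. A framed chart of D gives ℙD a frame
whose vector 0 lifts the tautological direction and whose other vectors span the fiber. In this
frame a line is vertical if and only if its component 0 vanishes (`FrameChart.vertical_iff`), so the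
affine chart of index 0 removes precisely the vertical lines (`isNonvertical_iff_exists_jetChart`).
The fiber coordinates added at each level are successive derivatives. Up to a linear reordering the
chart coordinates are therefore (x, u_0, …, u_k), and Δ_k becomes du_j = u_{j+1} dx
(`exists_frame_eq_iff`).

A Cartan point is nonvertical because the prolongation of an immersed curve projects onto the
immersed curve below, while its next line contains the velocity; a vertical line would kill the
velocity two levels down (`IsProlongation.isNonvertical`). Conversely, the jet coordinates of a
nonvertical point are the Taylor data of a polynomial, whose graph realizes the point
(`isCartan_iff`). The letter T adds nothing: following a baby monster down to its initial fiber, a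
critical point has a vertical projection or is itself vertical (`IsCritical.isVertical_or`).

For the orbit, a global shear carries the graph of 0 to any other graph. Prolongation is natural
under symmetries (`IsProlongation.map`) and unique as a germ (`IsProlongation.eventuallyEq`), so the
jets of the two graphs correspond. For the complement, an equation at one level is pulled back and
multiplied by an affine coordinate that cuts out the new vertical lines (`IsHypersurface.prolong`);
openness and density of the Cartan set follow. -/

lemma contMDiff_base :
    ContMDiff 𝓘(ℂ, E × (Fin r → ℂ)) 𝓘(ℂ, E) ω (Prolong.base (D := D)) := by
  intro q
  obtain ⟨f, i, hq⟩ := exists_affineChart q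
  have h1 : ContMDiffAt 𝓘(ℂ, E × (Fin r → ℂ)) 𝓘(ℂ, E) ω
      (f.chart.symm ∘ (Prod.fst ∘ f.affineHomeo i)) q := by
    refine ContMDiffAt.comp q (I' := 𝓘(ℂ, E))
      ((contMDiffOn_symm_of_mem_maximalAtlas f.mem_maximalAtlas).contMDiffAt
        (f.chart.open_target.mem_nhds (f.chart.map_source hq.1))) ?_
    exact ContMDiffAt.comp q (I' := 𝓘(ℂ, E × (Fin r → ℂ)))
      contDiff_fst.contMDiff.contMDiffAt
      ((contMDiffOn_of_mem_maximalAtlas (f.affineHomeo_mem i)).contMDiffAt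
        ((f.affineHomeo i).open_source.mem_nhds hq))
  refine h1.congr_of_eventuallyEq ?_
  filter_upwards [(f.affineHomeo i).open_source.mem_nhds hq] with q' hq'
  exact (f.chart.left_inv hq'.1).symm

lemma continuous_base : Continuous (Prolong.base (D := D)) := contMDiff_base.continuous

lemma surjective_base : Function.Surjective (Prolong.base (D := D)) :=
  fun p => ⟨⟨p, (nonempty_line D p).some⟩, rfl⟩

/-- In an affine chart the projection is `Prod.fst`. Openness serves to test a pulled back equation
on the image of an open set. -/
lemma isOpenMap_base : IsOpenMap (Prolong.base (D := D)) := by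
  rw [isOpenMap_iff_nhds_le]
  intro q
  obtain ⟨f, i, hq⟩ := exists_affineChart q
  have h1 : map (f.affineHomeo i) (𝓝 q) = 𝓝 (f.affineHomeo i q) :=
    (f.affineHomeo i).map_nhds_eq hq
  have h2 : map (Prod.fst : E × (Fin r → ℂ) → E) (𝓝 (f.affineHomeo i q)) =
      𝓝 (f.chart q.base) := map_fst_nhds _
  have h3 : map f.chart.symm (𝓝 (f.chart q.base)) = 𝓝 q.base :=
    f.chart.symm_map_nhds_eq hq.1
  rw [← h3, ← h2, ← h1, map_map, map_map]
  refine le_of_eq (Filter.map_congr ?_)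
  filter_upwards [(f.affineHomeo i).open_source.mem_nhds hq] with q' hq'
  exact f.chart.left_inv hq'.1

instance [T2Space M] : T2Space (Prolong D) := by
  refine t2Space_iff _ |>.2 ?_
  intro q q' hne
  by_cases hb : q.base = q'.base
  · obtain ⟨f, i, hq⟩ := exists_affineChart q
    have hq' : q'.base ∈ f.chart.source := hb ▸ hq.1
    by_cases hi : f.hom q' i ≠ 0
    · have hm : q' ∈ (f.affineHomeo i).source := ⟨hq', hi⟩
      obtain ⟨u, v, hu, hv, h1, h2, h3⟩ := t2_separation
        ((f.affineHomeo i).injOn.ne hq hm hne)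
      exact ⟨_, _, (f.affineHomeo i).isOpen_inter_preimage hu,
        (f.affineHomeo i).isOpen_inter_preimage hv, ⟨hq, h1⟩, ⟨hm, h2⟩,
        (h3.preimage _).mono inter_subset_right inter_subset_right⟩
    push Not at hi
    have h0 : f.hom q' ≠ 0 := f.coord_ne_zero hq' q'.line.rep.2
      fun h0 => q'.line.rep_nonzero (Subtype.ext h0)
    obtain ⟨k, hk⟩ := Function.ne_iff.1 h0
    have hm : q' ∈ (f.affineHomeo k).source := ⟨hq', hk⟩
    have hik : i ≠ k := by rintro rfl; exact hk hi
    by_cases hk' : f.hom q k ≠ 0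
    · have hm' : q ∈ (f.affineHomeo k).source := ⟨hq.1, hk'⟩
      obtain ⟨u, v, hu, hv, h1, h2, h3⟩ := t2_separation
        ((f.affineHomeo k).injOn.ne hm' hm hne)
      exact ⟨_, _, (f.affineHomeo k).isOpen_inter_preimage hu,
        (f.affineHomeo k).isOpen_inter_preimage hv, ⟨hm', h1⟩, ⟨hm, h2⟩,
        (h3.preimage _).mono inter_subset_right inter_subset_right⟩
    push Not at hk'
    obtain ⟨a, ha⟩ := Fin.exists_succAbove_eq hik.symm
    obtain ⟨b, hb⟩ := Fin.exists_succAbove_eq hik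
    -- Neither of the charts `i`, `k` contains both lines: the `k`-th homogeneous coordinate of `q`
    -- and the `i`-th of `q'` vanish. The disjoint conditions |X_k| < |X_i| and |X_i| < |X_k|
    -- separate them.
    have ho : ∀ c : Fin r, IsOpen {y : E × (Fin r → ℂ) | ‖y.2 c‖ < 1} := fun c =>
      isOpen_lt (by fun_prop) continuous_const
    refine ⟨_, _, (f.affineHomeo i).isOpen_inter_preimage (ho a),
      (f.affineHomeo k).isOpen_inter_preimage (ho b), ⟨hq, ?_⟩, ⟨hm, ?_⟩, ?_⟩
    · change ‖f.hom q (i.succAbove a) / f.hom q i‖ < 1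
      simp [ha, hk']
    · change ‖f.hom q' (k.succAbove b) / f.hom q' k‖ < 1
      simp [hb, hi]
    · rw [Set.disjoint_left]
      rintro s ⟨h1, h2⟩ ⟨h3, h4⟩
      change ‖f.hom s (i.succAbove a) / f.hom s i‖ < 1 at h2
      change ‖f.hom s (k.succAbove b) / f.hom s k‖ < 1 at h4
      rw [ha, norm_div, div_lt_one (norm_pos_iff.2 h1.2)] at h2
      rw [hb, norm_div, div_lt_one (norm_pos_iff.2 h3.2)] at h4
      exact lt_asymm h2 h4
  · obtain ⟨u, v, hu, hv, h1, h2, h3⟩ := t2_separation hb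
    exact ⟨_, _, hu.preimage continuous_base, hv.preimage continuous_base, h1, h2, h3.preimage _⟩

/-! ### Lines -/

lemma Prolong.mem_lineSpace_iff_rep {q : Prolong D} {v : TangentSpace 𝓘(ℂ, E) q.base} :
    v ∈ q.lineSpace ↔ ∃ c : ℂ, c • (q.line.rep : TangentSpace 𝓘(ℂ, E) q.base) = v := by
  rw [Prolong.lineSpace, Submodule.mem_map]
  constructor
  · rintro ⟨w, hw, rfl⟩
    rw [q.line.submodule_eq, Submodule.mem_span_singleton] at hw
    obtain ⟨c, rfl⟩ := hw
    exact ⟨c, rfl⟩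
  · rintro ⟨c, rfl⟩
    refine ⟨c • q.line.rep, ?_, rfl⟩
    rw [q.line.submodule_eq]
    exact Submodule.smul_mem _ _ (Submodule.mem_span_singleton_self _)

lemma Prolong.lineSpace_le (q : Prolong D) : q.lineSpace ≤ D.space q.base := by
  intro v hv
  obtain ⟨c, rfl⟩ := Prolong.mem_lineSpace_iff_rep.1 hv
  exact Submodule.smul_mem _ _ q.line.rep.2

lemma Prolong.rep_mem_lineSpace (q : Prolong D) :
    (q.line.rep : TangentSpace 𝓘(ℂ, E) q.base) ∈ q.lineSpace :=
  Prolong.mem_lineSpace_iff_rep.2 ⟨1, one_smul _ _⟩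

lemma Prolong.rep_ne_zero (q : Prolong D) : (q.line.rep : TangentSpace 𝓘(ℂ, E) q.base) ≠ 0 :=
  fun h0 => q.line.rep_nonzero (Subtype.ext h0)

lemma Prolong.lineSpace_le_of_mem {q : Prolong D} {v : TangentSpace 𝓘(ℂ, E) q.base}
    (hv : v ∈ q.lineSpace) (h0 : v ≠ 0) {S : Submodule ℂ (TangentSpace 𝓘(ℂ, E) q.base)}
    (h : v ∈ S) : q.lineSpace ≤ S := by
  obtain ⟨c, rfl⟩ := Prolong.mem_lineSpace_iff_rep.1 hv
  have hc : c ≠ 0 := by rintro rfl; exact h0 (zero_smul _ _)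
  intro w hw
  obtain ⟨d, rfl⟩ := Prolong.mem_lineSpace_iff_rep.1 hw
  have := S.smul_mem (d / c) h
  rwa [smul_smul, div_mul_cancel₀ _ hc] at this

lemma Prolong.mem_lineSpace_mk {p : M} {v : TangentSpace 𝓘(ℂ, E) p} (h : v ∈ D.space p)
    (h0 : (⟨v, h⟩ : D.space p) ≠ 0) {w : TangentSpace 𝓘(ℂ, E) p} :
    w ∈ Prolong.lineSpace (⟨p, Projectivization.mk ℂ ⟨v, h⟩ h0⟩ : Prolong D) ↔
      ∃ c : ℂ, c • v = w := by
  rw [Prolong.lineSpace, Submodule.mem_map]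
  simp only [Projectivization.submodule_mk]
  constructor
  · rintro ⟨w, hw, rfl⟩
    obtain ⟨c, rfl⟩ := Submodule.mem_span_singleton.1 hw
    exact ⟨c, rfl⟩
  · rintro ⟨c, rfl⟩
    exact ⟨c • ⟨v, h⟩, Submodule.smul_mem _ _ (Submodule.mem_span_singleton_self _), rfl⟩

/-- Two lines at the same point which share a nonzero vector are equal. -/
lemma Prolong.ext_of_mem {q q' : Prolong D} (hb : q.base = q'.base) {v : E} (h0 : v ≠ 0)
    (h : (v : TangentSpace 𝓘(ℂ, E) q.base) ∈ q.lineSpace)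
    (h' : (v : TangentSpace 𝓘(ℂ, E) q'.base) ∈ q'.lineSpace) : q = q' := by
  obtain ⟨p, l⟩ := q
  obtain ⟨p', l'⟩ := q'
  obtain rfl : p = p' := hb
  congr 1
  obtain ⟨c, hc⟩ := Prolong.mem_lineSpace_iff_rep.1 h
  obtain ⟨d, hd⟩ := Prolong.mem_lineSpace_iff_rep.1 h'
  have hcne : c ≠ 0 := by
    rintro rfl
    exact h0 (hc.symm.trans (zero_smul ℂ _))
  rw [← l.mk_rep, ← l'.mk_rep, Projectivization.mk_eq_mk_iff']
  refine ⟨c⁻¹ * d, Subtype.ext ?_⟩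
  have : d • (l'.rep : TangentSpace 𝓘(ℂ, E) p) = c • (l.rep : TangentSpace 𝓘(ℂ, E) p) :=
    hd.trans hc.symm
  change (c⁻¹ * d) • (l'.rep : TangentSpace 𝓘(ℂ, E) p) = l.rep
  rw [mul_smul, this, smul_smul, inv_mul_cancel₀ hcne, one_smul]

lemma FrameChart.hom_ne_zero (f : FrameChart r D.space) {q : Prolong D}
    (hq : q.base ∈ f.chart.source) : f.hom q ≠ 0 :=
  f.coord_ne_zero hq q.line.rep.2 q.rep_ne_zero

lemma FrameChart.coord_eq_smul_hom (f : FrameChart r D.space) {q : Prolong D}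
    {v : TangentSpace 𝓘(ℂ, E) q.base} (hv : v ∈ q.lineSpace) :
    ∃ c : ℂ, f.coord q.base v = c • f.hom q := by
  obtain ⟨c, rfl⟩ := Prolong.mem_lineSpace_iff_rep.1 hv
  exact ⟨c, f.coord_smul _ _ _⟩

/-- The line of a point, read in an affine chart. -/
lemma FrameChart.mem_lineSpace_iff (f : FrameChart r D.space) (i : Fin (r + 1)) {q : Prolong D}
    (hq : q ∈ (f.affineChart i).source) {v : TangentSpace 𝓘(ℂ, E) q.base} :
    v ∈ q.lineSpace ↔ mfderiv 𝓘(ℂ, E) 𝓘(ℂ, E) f.chart q.base v =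
      (f.coord q.base v i) • f.frame (f.chart q.base)
        (i.insertNth (1 : ℂ) (f.affineChart i q).2) := by
  have hi : f.hom q i ≠ 0 := hq.2
  have hh : f.hom q i • (i.insertNth (1 : ℂ) (f.affineChart i q).2 : Fin (r + 1) → ℂ) = f.hom q := by
    ext j
    refine Fin.succAboveCases i ?_ (fun j => ?_) j
    · simp
    · simp only [Pi.smul_apply, Fin.insertNth_apply_succAbove, smul_eq_mul]
      change f.hom q i * (f.hom q (i.succAbove j) / f.hom q i) = _
      field_simp
  constructor
  · intro hv
    obtain ⟨c, hc⟩ := f.coord_eq_smul_hom hv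
    rw [← f.frame_coord hq.1 (q.lineSpace_le hv), ← map_smul]
    congr 1
    rw [hc, Pi.smul_apply, smul_eq_mul, mul_smul, hh]
  · intro hv
    rw [Prolong.mem_lineSpace_iff_rep]
    refine ⟨f.coord q.base v i / f.hom q i, f.mdiff.mfderiv_injective hq.1 ?_⟩
    have h2 := f.frame_coord hq.1 q.line.rep.2
    change f.frame (f.chart q.base) (f.hom q) = _ at h2
    rw [← hh, map_smul] at h2
    rw [hv, ContinuousLinearMap.map_smul, ← h2]
    refine (smul_smul (α := E) _ _ _).trans ?_
    rw [div_mul_cancel₀ _ hi]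

/-- A line in the prolonged distribution is vertical when its first component vanishes. -/
lemma FrameChart.vertical_iff (f : FrameChart r D.space) (i : Fin (r + 1)) {q : Prolong D.prolong}
    (hq : q.base ∈ (f.affineChart i).source) :
    q.lineSpace ≤ (mfderiv 𝓘(ℂ, E × (Fin r → ℂ)) 𝓘(ℂ, E) (Prolong.base (D := D)) q.base).ker ↔
      FrameChart.hom (D := D.prolong) (f.prolongChart i) q 0 = 0 := by
  set v : TangentSpace 𝓘(ℂ, E × (Fin r → ℂ)) q.base := q.line.rep.1
  -- Component 0 of the prolonged coframe reads the `i`-th component of the projected vector.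
  have h1 : FrameChart.hom (D := D.prolong) (f.prolongChart i) q 0 =
      f.coord q.base.base
        (mfderiv 𝓘(ℂ, E × (Fin r → ℂ)) 𝓘(ℂ, E) (Prolong.base (D := D)) q.base v) i := by
    rw [FrameChart.coord, f.mfderiv_proj i hq]
    rfl
  have hv : mfderiv 𝓘(ℂ, E × (Fin r → ℂ)) 𝓘(ℂ, E) (Prolong.base (D := D)) q.base v ∈
      q.base.lineSpace := q.line.rep.2
  rw [h1]
  constructor
  · intro h
    have : mfderiv 𝓘(ℂ, E × (Fin r → ℂ)) 𝓘(ℂ, E) (Prolong.base (D := D)) q.base v = 0 :=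
      h q.rep_mem_lineSpace
    rw [this, f.coord_zero]
    rfl
  · intro h
    refine Prolong.lineSpace_le_of_mem q.rep_mem_lineSpace q.rep_ne_zero ?_
    change mfderiv 𝓘(ℂ, E × (Fin r → ℂ)) 𝓘(ℂ, E) (Prolong.base (D := D)) q.base v = 0
    -- The projected vector lies on the tautological line, whose `i`-th homogeneous coordinate is
    -- nonzero, so its `i`-th component decides whether it vanishes.
    obtain ⟨c, hc⟩ := f.coord_eq_smul_hom hv
    have hc0 : c = 0 := by
      rw [hc] at h
      simpa [hq.2] using h
    refine f.coord_injOn hq.1 (q.base.lineSpace_le hv) (Submodule.zero_mem _) ?_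
    rw [hc, hc0, zero_smul, f.coord_zero]

end General

section General

variable {E : Type} [NormedAddCommGroup E] [NormedSpace ℂ E]
  {M : Type} [TopologicalSpace M] [ChartedSpace E M] {r : ℕ} {D : Distribution E M r}
  {E' : Type} [NormedAddCommGroup E'] [NormedSpace ℂ E']
  {M' : Type} [TopologicalSpace M'] [ChartedSpace E' M']

/-! ### Curves -/

lemma velocity_comp {c : ℂ → M} {t : ℂ} {g : M → M'}
    (hg : MDifferentiableAt 𝓘(ℂ, E) 𝓘(ℂ, E') g (c t))
    (hc : MDifferentiableAt 𝓘(ℂ, ℂ) 𝓘(ℂ, E) c t) :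
    velocity (E := E') (g ∘ c) t =
      mfderiv 𝓘(ℂ, E) 𝓘(ℂ, E') g (c t) (velocity (E := E) c t) := by
  rw [velocity, mfderiv_comp (I' := 𝓘(ℂ, E)) t hg hc]
  rfl

/-- The equality is read in `E`, since the two tangent spaces are attached to different expressions
for the base point. The same ascription recurs below. -/
lemma velocity_congr {c c' : ℂ → M} {t : ℂ} (h : c =ᶠ[𝓝 t] c') :
    (velocity (E := E) c t : E) = velocity (E := E) c' t := by
  have := h.mfderiv_eq (I := 𝓘(ℂ, ℂ)) (I' := 𝓘(ℂ, E))
  exact congrArg (fun L : ℂ →L[ℂ] E => L 1) this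

/-- Equality of points of `ℙD` involves dependent proofs; a base point equation and membership of a
vector are easier to transport. -/
lemma isCurveProlong_iff {c : ℂ → M} {C : ℂ → Prolong D} :
    IsCurveProlong D c C ↔ ContMDiffAt 𝓘(ℂ, ℂ) 𝓘(ℂ, E × (Fin r → ℂ)) ω C 0 ∧
      ∀ᶠ t in 𝓝[≠] (0 : ℂ), (C t).base = c t ∧ (velocity (E := E) c t : E) ≠ 0 ∧
        (velocity (E := E) c t : E) ∈ ((C t).lineSpace : Submodule ℂ E) := by
  refine and_congr_right fun _ => eventually_congr (Eventually.of_forall fun t => ?_)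
  constructor
  · rintro ⟨h, h0, e⟩
    rw [e]
    exact ⟨rfl, fun h1 => h0 (Subtype.ext h1), (Prolong.mem_lineSpace_mk h h0).2 ⟨1, one_smul _ _⟩⟩
  · rintro ⟨hb, h0, hm⟩
    have hD : velocity (E := E) c t ∈ D.space (c t) := by
      have := (C t).lineSpace_le hm
      generalize (velocity (E := E) c t : E) = v at this
      change (v : TangentSpace 𝓘(ℂ, E) (c t)) ∈ D.space (c t)
      rw [← hb]
      exact this
    refine ⟨hD, fun h1 => h0 (congrArg Subtype.val h1), ?_⟩
    exact Prolong.ext_of_mem hb h0 hm ((Prolong.mem_lineSpace_mk _ _).2 ⟨1, one_smul _ _⟩)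

/-- The definition only concerns t ≠ 0; continuity and the Hausdorff property add t = 0. -/
lemma IsCurveProlong.base_comp_eventuallyEq [T2Space M] {c : ℂ → M} {C : ℂ → Prolong D}
    (h : IsCurveProlong D c C) (hc : ContinuousAt c 0) : Prolong.base ∘ C =ᶠ[𝓝 0] c := by
  refine (ContinuousAt.eventuallyEq_nhds_iff_eventuallyEq_nhdsNE
    (continuous_base.continuousAt.comp h.1.continuousAt) hc).1 ?_
  exact (isCurveProlong_iff.1 h).2.mono fun t ht => ht.1

lemma IsCurveProlong.eventuallyEq [T2Space M] {c c' : ℂ → M} {C C' : ℂ → Prolong D}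
    (h : IsCurveProlong D c C) (h' : IsCurveProlong D c' C') (hc : c =ᶠ[𝓝 0] c') :
    C =ᶠ[𝓝 0] C' := by
  refine (ContinuousAt.eventuallyEq_nhds_iff_eventuallyEq_nhdsNE
    h.1.continuousAt h'.1.continuousAt).1 ?_
  filter_upwards [(isCurveProlong_iff.1 h).2, (isCurveProlong_iff.1 h').2,
    hc.eventuallyEq_nhds.filter_mono nhdsWithin_le_nhds] with t h1 h2 h3
  refine Prolong.ext_of_mem (h1.1.trans (h3.eq_of_nhds.trans h2.1.symm)) h1.2.1 h1.2.2 ?_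
  rw [velocity_congr h3]
  exact h2.2.2

lemma contMDiffAt_eventually_mdifferentiableAt {c : ℂ → M} {t : ℂ} [IsManifold 𝓘(ℂ, E) ω M]
    (hc : ContMDiffAt 𝓘(ℂ, ℂ) 𝓘(ℂ, E) ω c t) :
    ∀ᶠ s in 𝓝 t, MDifferentiableAt 𝓘(ℂ, ℂ) 𝓘(ℂ, E) c s :=
  ((contMDiffAt_iff_contMDiffAt_nhds (by simp)).1 hc).mono fun _ hs => hs.mdifferentiableAt (by simp)

/-- The line of a prolonged curve at `0` contains the velocity of the curve, also at `0`. -/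
lemma IsCurveProlong.velocity_mem [T2Space M] [IsManifold 𝓘(ℂ, E) ω M]
    {c : ℂ → M} {C : ℂ → Prolong D}
    (h : IsCurveProlong D c C) (hc : ContMDiffAt 𝓘(ℂ, ℂ) 𝓘(ℂ, E) ω c 0) :
    (velocity (E := E) c 0 : E) ∈ ((C 0).lineSpace : Submodule ℂ E) := by
  obtain ⟨f, i, hq⟩ := exists_affineChart (C 0)
  have hb := h.base_comp_eventuallyEq hc.continuousAt
  have hC := h.1.continuousAt
  have hf : ContMDiffAt 𝓘(ℂ, E) 𝓘(ℂ, E) ω f.chart (c 0) := by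
    rw [← hb.eq_of_nhds]
    exact (contMDiffOn_of_mem_maximalAtlas f.mem_maximalAtlas).contMDiffAt
      (f.chart.open_source.mem_nhds hq.1)
  set y : ℂ → E := f.chart ∘ c with hy
  have hyd : ContDiffAt ℂ ω y 0 := (hf.comp (0 : ℂ) hc).contDiffAt
  have hdy : ContinuousAt (deriv y) 0 :=
    ContDiffAt.continuousAt (ContDiffAt.derivWithin (m := ω) hyd le_rfl)
  have hsrc : ∀ᶠ t in 𝓝 (0 : ℂ), C t ∈ (f.affineHomeo i).source :=
    hC.eventually_mem ((f.affineHomeo i).open_source.mem_nhds hq)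
  have hder : ∀ᶠ t in 𝓝 (0 : ℂ), deriv y t =
      mfderiv 𝓘(ℂ, E) 𝓘(ℂ, E) f.chart (C t).base (velocity (E := E) c t : E) := by
    filter_upwards [hsrc, hb.eventuallyEq_nhds, contMDiffAt_eventually_mdifferentiableAt hc]
      with t h1 h2 h3
    have h4 : (C t).base = c t := h2.eq_of_nhds
    have h5 : c t ∈ f.chart.source := h4 ▸ h1.1
    rw [h4, ← velocity_comp (E := E) (E' := E) (f.mdiff.mdifferentiableAt h5) h3]
    change deriv y t = mfderiv 𝓘(ℂ, ℂ) 𝓘(ℂ, E) y t (1 : ℂ)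
    rw [mfderiv_eq_fderiv]
    rfl
  have hz : ContinuousAt (fun t => f.affineChart i (C t)) 0 :=
    ((f.affineHomeo i).continuousAt hq).comp hC
  set z : ℂ → E × (Fin r → ℂ) := fun t => f.affineChart i (C t) with hzdef
  have hz0 : (z 0).1 ∈ f.chart.target := f.chart.map_source hq.1
  have hz1 : ContinuousAt (fun t => (z t).1) 0 := hz.fst
  have hz2 : ContinuousAt (fun t => (i.insertNth (1 : ℂ) (z t).2 : Fin (r + 1) → ℂ)) 0 :=
    ((FrameChart.contDiff_insertNth i).continuous.continuousAt).comp hz.snd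
  have hco : ContinuousAt (fun t => f.coframe (z t).1 (deriv y t) i) 0 := by
    have h1 : ContinuousAt (fun t => f.coframe (z t).1) 0 :=
      ContinuousAt.comp (g := f.coframe) (f := fun t => (z t).1)
        (f.contDiffOn_coframe.continuousOn.continuousAt (f.chart.open_target.mem_nhds hz0)) hz1
    exact (continuous_apply i).continuousAt.comp (h1.clm_apply hdy)
  have hfr : ContinuousAt (fun t => f.frame (z t).1 (i.insertNth (1 : ℂ) (z t).2)) 0 := by
    have h1 : ContinuousAt (fun t => f.frame (z t).1) 0 :=
      ContinuousAt.comp (g := f.frame) (f := fun t => (z t).1)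
        (f.contDiffOn_frame.continuousOn.continuousAt (f.chart.open_target.mem_nhds hz0)) hz1
    exact h1.clm_apply hz2
  have hsm : ContinuousAt (fun t => f.coframe (z t).1 (deriv y t) i •
      f.frame (z t).1 (i.insertNth (1 : ℂ) (z t).2)) 0 := hco.smul hfr
  -- Read in the charts, membership of the velocity in the line is an equality of two functions
  -- continuous at 0, so it passes from t ≠ 0 to the limit, even where the velocity vanishes.
  have key : deriv y =ᶠ[𝓝 0] fun t => f.coframe (z t).1 (deriv y t) i •
      f.frame (z t).1 (i.insertNth (1 : ℂ) (z t).2) := by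
    refine (ContinuousAt.eventuallyEq_nhds_iff_eventuallyEq_nhdsNE hdy hsm).1 ?_
    filter_upwards [(isCurveProlong_iff.1 h).2, hsrc.filter_mono nhdsWithin_le_nhds,
      hder.filter_mono nhdsWithin_le_nhds] with t h1 h2 h3
    simp only [h3]
    exact (f.mem_lineSpace_iff i h2).1 h1.2.2
  refine (f.mem_lineSpace_iff i hq).2 ?_
  have h1 := key.eq_of_nhds
  rw [hder.self_of_nhds] at h1
  exact h1

/-- The prolongation of a curve, given in a chart. -/
lemma isCurveProlong_chart (f : FrameChart r D.space) (i : Fin (r + 1)) {y : ℂ → E}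
    {w : ℂ → Fin r → ℂ} (hy : ContDiff ℂ ω y) (hw : ContDiff ℂ ω w)
    (ht : ∀ t, y t ∈ f.chart.target)
    (hd : ∀ t, deriv y t = f.frame (y t) (i.insertNth (1 : ℂ) (w t))) :
    IsCurveProlong D (f.chart.symm ∘ y) ((f.affineHomeo i).symm ∘ fun t => (y t, w t)) := by
  rw [isCurveProlong_iff]
  constructor
  · refine ContMDiffAt.comp (0 : ℂ) (I' := 𝓘(ℂ, E × (Fin r → ℂ)))
      ((contMDiffOn_symm_of_mem_maximalAtlas (f.affineHomeo_mem i)).contMDiffAt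
        ((f.affineHomeo i).open_target.mem_nhds (ht 0))) ?_
    exact (hy.prodMk hw).contMDiff.contMDiffAt
  · refine Eventually.of_forall fun t => ?_
    have ha := FrameChart.insertNth_ne_zero i (w t)
    have hv : velocity (E := E) (f.chart.symm ∘ y) t = f.vec (y t) (i.insertNth (1 : ℂ) (w t)) := by
      rw [velocity_comp (E := E) (f.mdiff.mdifferentiableAt_symm (ht t))
        (hy.contMDiff.contMDiffAt.mdifferentiableAt (by simp))]
      rw [FrameChart.vec, ← hd]
      congr 1
      change mfderiv 𝓘(ℂ, ℂ) 𝓘(ℂ, E) y t (1 : ℂ) = _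
      rw [mfderiv_eq_fderiv]
      rfl
    obtain ⟨h0, e⟩ := f.lineOf_eq (ht t) ha
    refine ⟨rfl, ?_, ?_⟩
    · rw [hv]
      exact fun h1 => h0 (Subtype.ext h1)
    · rw [hv]
      change _ ∈ Prolong.lineSpace ⟨f.chart.symm (y t), f.lineOf (y t) (i.insertNth (1 : ℂ) (w t))⟩
      rw [e]
      exact (Prolong.mem_lineSpace_mk _ _).2 ⟨1, one_smul _ _⟩

end General

section General

variable {E : Type} [NormedAddCommGroup E] [NormedSpace ℂ E]
  {M : Type} [TopologicalSpace M] [ChartedSpace E M] {r : ℕ} {D : Distribution E M r}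

/-! ### Symmetries -/

variable (D) in
/-- The map `φ` is an analytic symmetry of `D` on the open set `U`, with left inverse `φ'`. -/
structure IsSymmetryOn (φ φ' : M → M) (U V : Set M) : Prop where
  isOpen : IsOpen U
  mapsTo : MapsTo φ U V
  contMDiffOn : ContMDiffOn 𝓘(ℂ, E) 𝓘(ℂ, E) ω φ U
  left_inv : ∀ p ∈ U, φ' (φ p) = p
  map_mem : ∀ p ∈ U, ∀ v ∈ D.space p, mfderiv 𝓘(ℂ, E) 𝓘(ℂ, E) φ p v ∈ D.space (φ p)

variable (D) in
/-- Mutually inverse analytic symmetries of `D` between the open sets `U` and `V`. -/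
structure IsSymmetryPair (φ φ' : M → M) (U V : Set M) : Prop where
  left : IsSymmetryOn D φ φ' U V
  right : IsSymmetryOn D φ' φ V U

variable {φ φ' : M → M} {U V : Set M}

lemma IsSymmetryPair.symm (h : IsSymmetryPair D φ φ' U V) : IsSymmetryPair D φ' φ V U :=
  ⟨h.right, h.left⟩

lemma IsSymmetryOn.contMDiffAt (h : IsSymmetryOn D φ φ' U V) {p : M} (hp : p ∈ U) :
    ContMDiffAt 𝓘(ℂ, E) 𝓘(ℂ, E) ω φ p :=
  h.contMDiffOn.contMDiffAt (h.isOpen.mem_nhds hp)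

lemma IsSymmetryOn.mdifferentiableAt (h : IsSymmetryOn D φ φ' U V) {p : M} (hp : p ∈ U) :
    MDifferentiableAt 𝓘(ℂ, E) 𝓘(ℂ, E) φ p :=
  (h.contMDiffAt hp).mdifferentiableAt (by simp)

lemma IsSymmetryPair.mfderiv_mfderiv (h : IsSymmetryPair D φ φ' U V) {p : M} (hp : p ∈ U)
    (v : TangentSpace 𝓘(ℂ, E) p) :
    (mfderiv 𝓘(ℂ, E) 𝓘(ℂ, E) φ' (φ p) (mfderiv 𝓘(ℂ, E) 𝓘(ℂ, E) φ p v) : E) = v := by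
  have h1 := mfderiv_comp (I' := 𝓘(ℂ, E)) p
    (h.right.mdifferentiableAt (h.left.mapsTo hp)) (h.left.mdifferentiableAt hp)
  have h2 : φ' ∘ φ =ᶠ[𝓝 p] id := by
    filter_upwards [h.left.isOpen.mem_nhds hp] with q hq using h.left.left_inv q hq
  have h3 := h2.mfderiv_eq (I := 𝓘(ℂ, E)) (I' := 𝓘(ℂ, E))
  rw [mfderiv_id] at h3
  have h4 := congrArg (fun L : E →L[ℂ] E => L v) h3
  refine Eq.trans ?_ h4
  rw [h1]
  rfl

lemma IsSymmetryPair.mfderiv_injective (h : IsSymmetryPair D φ φ' U V) {p : M} (hp : p ∈ U) :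
    Function.Injective (mfderiv 𝓘(ℂ, E) 𝓘(ℂ, E) φ p) := fun v w e =>
  (h.mfderiv_mfderiv hp v).symm.trans (e ▸ h.mfderiv_mfderiv hp w)

/-- The condition in `prolongMap` holds because the differential preserves D and is inverted by that
of `φ'`. By `Prolong.ext_of_mem` these two properties determine the image, so the definition need
not be unfolded again. -/
lemma IsSymmetryPair.prolongMap_spec (h : IsSymmetryPair D φ φ' U V) {q : Prolong D}
    (hq : q.base ∈ U) : (prolongMap D φ q).base = φ q.base ∧
      ∀ v ∈ q.lineSpace, (mfderiv 𝓘(ℂ, E) 𝓘(ℂ, E) φ q.base v : E) ∈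
        ((prolongMap D φ q).lineSpace : Submodule ℂ E) := by
  have h1 : ∃ h1 : ∀ v ∈ D.space q.base,
      (mfderiv 𝓘(ℂ, E) 𝓘(ℂ, E) φ q.base).toLinearMap v ∈ D.space (φ q.base),
      Function.Injective
        ((mfderiv 𝓘(ℂ, E) 𝓘(ℂ, E) φ q.base).toLinearMap.restrict h1) := by
    refine ⟨h.left.map_mem _ hq, fun v w e => Subtype.ext (h.mfderiv_injective hq ?_)⟩
    exact congrArg Subtype.val e
  have key : prolongMap D φ q = ⟨φ q.base, Projectivization.mk ℂ
      ((mfderiv 𝓘(ℂ, E) 𝓘(ℂ, E) φ q.base).toLinearMap.restrict h1.1 q.line.rep)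
      (fun h0 => q.line.rep_nonzero (h1.2 (h0.trans (map_zero _).symm)))⟩ := by
    rw [prolongMap, dif_pos h1]
    congr 1
    conv_lhs => rw [← q.line.mk_rep]
    rw [Projectivization.map_mk]
  rw [key]
  refine ⟨rfl, fun v hv => ?_⟩
  obtain ⟨c, rfl⟩ := Prolong.mem_lineSpace_iff_rep.1 hv
  refine (Prolong.mem_lineSpace_mk (D := D) (h1.1 _ q.line.rep.2) _).2 ⟨c, ?_⟩
  exact (ContinuousLinearMap.map_smul _ _ _).symm

namespace FrameChart

variable (f g : FrameChart r D.space)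

/-- The components of the differential of `φ` with respect to two frames. -/
def changeMap (φ : M → M) (x : E) : (Fin (r + 1) → ℂ) →L[ℂ] (Fin (r + 1) → ℂ) :=
  (g.coframe (g.chart (φ (f.chart.symm x)))).comp
    ((fderiv ℂ (g.chart ∘ φ ∘ f.chart.symm) x).comp (f.frame x))

lemma coord_mfderiv {p : M} (hf : p ∈ f.chart.source) (hg : φ p ∈ g.chart.source)
    (hφ : MDifferentiableAt 𝓘(ℂ, E) 𝓘(ℂ, E) φ p) {v : TangentSpace 𝓘(ℂ, E) p}
    (hv : v ∈ D.space p) :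
    g.coord (φ p) (mfderiv 𝓘(ℂ, E) 𝓘(ℂ, E) φ p v) =
      f.changeMap g φ (f.chart p) (f.coord p v) := by
  have hx := f.chart.map_source hf
  have hl := f.chart.left_inv hf
  have h1 : MDifferentiableAt 𝓘(ℂ, E) 𝓘(ℂ, E) φ (f.chart.symm (f.chart p)) := by rwa [hl]
  have h2 : MDifferentiableAt 𝓘(ℂ, E) 𝓘(ℂ, E) g.chart (φ (f.chart.symm (f.chart p))) := by
    rw [hl]
    exact g.mdiff.mdifferentiableAt hg
  have hG : MDifferentiableAt 𝓘(ℂ, E) 𝓘(ℂ, E) (g.chart ∘ φ ∘ f.chart.symm) (f.chart p) :=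
    MDifferentiableAt.comp (I' := 𝓘(ℂ, E)) (f.chart p) h2
      (h1.comp (I' := 𝓘(ℂ, E)) (f.chart p) (f.mdiff.mdifferentiableAt_symm hx))
  have h3 : (g.chart ∘ φ ∘ f.chart.symm) ∘ f.chart =ᶠ[𝓝 p] g.chart ∘ φ := by
    filter_upwards [f.chart.open_source.mem_nhds hf] with s hs
    simp [f.chart.left_inv hs]
  have h4 := h3.mfderiv_eq (I := 𝓘(ℂ, E)) (I' := 𝓘(ℂ, E))
  rw [mfderiv_comp (I' := 𝓘(ℂ, E)) p hG (f.mdiff.mdifferentiableAt hf),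
    mfderiv_comp (I' := 𝓘(ℂ, E)) p (g.mdiff.mdifferentiableAt hg) hφ, mfderiv_eq_fderiv] at h4
  have h5 := congrArg (fun L : E →L[ℂ] E => L v) h4
  have h6 : f.changeMap g φ (f.chart p) (f.coord p v) =
      g.coframe (g.chart (φ (f.chart.symm (f.chart p)))) (fderiv ℂ (g.chart ∘ φ ∘ f.chart.symm)
        (f.chart p) (f.frame (f.chart p) (f.coord p v))) := rfl
  rw [h6, f.frame_coord hf hv, hl]
  exact congrArg (g.coframe (g.chart (φ p))) h5.symm

lemma isOpen_changeMap_domain (hU : IsOpen U) (hφ : ContMDiffOn 𝓘(ℂ, E) 𝓘(ℂ, E) ω φ U) :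
    IsOpen (f.chart.target ∩ f.chart.symm ⁻¹' (U ∩ φ ⁻¹' g.chart.source)) :=
  f.chart.symm.isOpen_inter_preimage
    (hφ.continuousOn.isOpen_inter_preimage hU g.chart.open_source)

lemma contDiffOn_map (hφ : ContMDiffOn 𝓘(ℂ, E) 𝓘(ℂ, E) ω φ U) :
    ContDiffOn ℂ ω (g.chart ∘ φ ∘ f.chart.symm)
      (f.chart.target ∩ f.chart.symm ⁻¹' (U ∩ φ ⁻¹' g.chart.source)) := by
  have h1 : ContMDiffOn 𝓘(ℂ, E) 𝓘(ℂ, E) ω (φ ∘ f.chart.symm)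
      (f.chart.target ∩ f.chart.symm ⁻¹' (U ∩ φ ⁻¹' g.chart.source)) :=
    hφ.comp ((contMDiffOn_symm_of_mem_maximalAtlas f.mem_maximalAtlas).mono inter_subset_left)
      fun x hx => hx.2.1
  have h2 := (contMDiffOn_of_mem_maximalAtlas g.mem_maximalAtlas).comp h1 fun x hx => hx.2.2
  exact h2.contDiffOn

lemma contDiffOn_changeMap (hU : IsOpen U) (hφ : ContMDiffOn 𝓘(ℂ, E) 𝓘(ℂ, E) ω φ U) :
    ContDiffOn ℂ ω (f.changeMap g φ)
      (f.chart.target ∩ f.chart.symm ⁻¹' (U ∩ φ ⁻¹' g.chart.source)) := by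
  have h := f.contDiffOn_map g hφ
  have h1 := g.contDiffOn_coframe.comp h fun x hx => g.chart.map_source hx.2.2
  have h2 := h.fderiv_of_isOpen (m := ω) (f.isOpen_changeMap_domain g hU hφ) (by simp)
  exact h1.clm_comp (h2.clm_comp (f.contDiffOn_frame.mono inter_subset_left))

end FrameChart

/-- The homogeneous coordinates of the image line are proportional to the matrix of dφ applied to
those of the line. In affine charts the map is thus a quotient of analytic functions, fractional
linear in the fiber. -/
lemma IsSymmetryPair.contMDiffAt_prolongMap (h : IsSymmetryPair D φ φ' U V) {q : Prolong D}
    (hq : q.base ∈ U) :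
    ContMDiffAt 𝓘(ℂ, E × (Fin r → ℂ)) 𝓘(ℂ, E × (Fin r → ℂ)) ω (prolongMap D φ) q := by
  obtain ⟨f, i, hf⟩ := exists_affineChart q
  obtain ⟨g, k, hg⟩ := exists_affineChart (prolongMap D φ q)
  have hb := (h.prolongMap_spec hq).1
  have hUo := h.left.isOpen
  have hφ := h.left.contMDiffOn
  set W := f.chart.target ∩ f.chart.symm ⁻¹' (U ∩ φ ⁻¹' g.chart.source) with hW
  set A : E × (Fin r → ℂ) → Fin (r + 1) → ℂ :=
    fun y => f.changeMap g φ y.1 (i.insertNth (1 : ℂ) y.2) with hA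
  have hAd : ContDiffOn ℂ ω A {y | y.1 ∈ W} := by
    have h1 : ContDiffOn ℂ ω (fun y : E × (Fin r → ℂ) => f.changeMap g φ y.1) {y | y.1 ∈ W} :=
      (f.contDiffOn_changeMap g hUo hφ).comp contDiff_fst.contDiffOn fun y hy => hy
    exact h1.clm_apply ((FrameChart.contDiff_insertNth i).comp contDiff_snd).contDiffOn
  have hWo : IsOpen {y : E × (Fin r → ℂ) | y.1 ∈ W} :=
    (f.isOpen_changeMap_domain g hUo hφ).preimage continuous_fst
  have hlocal : ∀ s : Prolong D, s ∈ (f.affineChart i).source → s.base ∈ U →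
      φ s.base ∈ g.chart.source → (f.affineChart i s).1 ∈ W ∧
        ∃ c : ℂ, c ≠ 0 ∧ g.hom (prolongMap D φ s) = c • A (f.affineChart i s) := by
    intro s hs hsU hsg
    refine ⟨⟨f.chart.map_source hs.1, ?_⟩, ?_⟩
    · change f.chart.symm (f.chart s.base) ∈ U ∩ φ ⁻¹' g.chart.source
      rw [f.chart.left_inv hs.1]
      exact ⟨hsU, hsg⟩
    obtain ⟨hsb, hsl⟩ := h.prolongMap_spec hsU
    have hm := s.rep_mem_lineSpace
    obtain ⟨c, hc⟩ := g.coord_eq_smul_hom (hsl _ hm)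
    have e : g.coord (φ s.base) (mfderiv 𝓘(ℂ, E) 𝓘(ℂ, E) φ s.base s.line.rep.1) =
        f.hom s i • A (f.affineChart i s) := by
      rw [f.coord_mfderiv g hs.1 hsg (h.left.mdifferentiableAt hsU) s.line.rep.2, hA, ← map_smul]
      congr 1
      have hi : f.hom s i ≠ 0 := hs.2
      ext j
      refine Fin.succAboveCases i ?_ (fun j => ?_) j
      · simp [FrameChart.hom]
      · simp only [Pi.smul_apply, Fin.insertNth_apply_succAbove, smul_eq_mul]
        change _ = f.hom s i * (f.hom s (i.succAbove j) / f.hom s i)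
        field_simp
        rfl
    have e2 : g.coord (φ s.base) (mfderiv 𝓘(ℂ, E) 𝓘(ℂ, E) φ s.base s.line.rep.1) =
        c • g.hom (prolongMap D φ s) := by
      rw [← hc, hsb]
    have hcne : c ≠ 0 := by
      rintro rfl
      rw [zero_smul] at e2
      refine g.coord_ne_zero hsg (h.left.map_mem _ hsU _ s.line.rep.2) ?_ e2
      intro h0
      exact s.rep_ne_zero (h.mfderiv_injective hsU (h0.trans (map_zero _).symm))
    refine ⟨c⁻¹ * f.hom s i, mul_ne_zero (inv_ne_zero hcne) hs.2, ?_⟩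
    rw [mul_smul, ← e, e2, smul_smul, inv_mul_cancel₀ hcne, one_smul]
  -- The expression of the prolonged map in the affine charts; the proportionality factor `c` of
  -- `hlocal` cancels in the ratios.
  set F : E × (Fin r → ℂ) → E × (Fin r → ℂ) := fun y =>
    (g.chart (φ (f.chart.symm y.1)), fun j => A y (k.succAbove j) / A y k) with hF
  have hqg : φ q.base ∈ g.chart.source := hb ▸ hg.1
  obtain ⟨hqW, c, hc, hqh⟩ := hlocal q hf hq hqg
  have hAk : A (f.affineChart i q) k ≠ 0 := by
    intro h0
    have := hg.2
    rw [hqh] at this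
    simp [h0] at this
  have hFd : ContDiffAt ℂ ω F (f.affineChart i q) := by
    have h1 : ContDiffAt ℂ ω A (f.affineChart i q) := hAd.contDiffAt (hWo.mem_nhds hqW)
    refine ContDiffAt.prodMk ?_ (contDiffAt_pi.2 fun j => ?_)
    · exact ((f.contDiffOn_map g hφ).contDiffAt
        ((f.isOpen_changeMap_domain g hUo hφ).mem_nhds hqW)).comp _ contDiffAt_fst
    · exact (contDiffAt_pi.1 h1 _).div (contDiffAt_pi.1 h1 k) hAk
  have hFt : F (f.affineChart i q) ∈ (g.affineHomeo k).target := g.chart.map_source hqW.2.2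
  have hcomp : ContMDiffAt 𝓘(ℂ, E × (Fin r → ℂ)) 𝓘(ℂ, E × (Fin r → ℂ)) ω
      ((g.affineHomeo k).symm ∘ (F ∘ f.affineHomeo i)) q := by
    refine ContMDiffAt.comp q (I' := 𝓘(ℂ, E × (Fin r → ℂ)))
      ((contMDiffOn_symm_of_mem_maximalAtlas (g.affineHomeo_mem k)).contMDiffAt
        ((g.affineHomeo k).open_target.mem_nhds hFt)) ?_
    exact ContMDiffAt.comp q (I' := 𝓘(ℂ, E × (Fin r → ℂ))) hFd.contMDiffAt
      ((contMDiffOn_of_mem_maximalAtlas (f.affineHomeo_mem i)).contMDiffAt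
        ((f.affineHomeo i).open_source.mem_nhds hf))
  refine hcomp.congr_of_eventuallyEq ?_
  have hAc : ContinuousAt (fun s => A (f.affineHomeo i s) k) q :=
    ContinuousAt.comp (g := fun y => A y k) (f := f.affineHomeo i)
      ((continuous_apply k).continuousAt.comp
        (hAd.continuousOn.continuousAt (hWo.mem_nhds hqW)))
      ((f.affineHomeo i).continuousAt hf)
  have hφc : ContinuousAt (fun s : Prolong D => φ s.base) q :=
    (h.left.contMDiffAt hq).continuousAt.comp continuous_base.continuousAt
  filter_upwards [(f.affineHomeo i).open_source.mem_nhds hf,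
    continuous_base.continuousAt.eventually_mem (hUo.mem_nhds hq),
    hφc.eventually_mem (g.chart.open_source.mem_nhds hqg), hAc.eventually_ne hAk]
    with s hs hsU hsg hsk
  obtain ⟨hsW, d, hd, hsh⟩ := hlocal s hs hsU hsg
  have hsb := (h.prolongMap_spec hsU).1
  have hmem : prolongMap D φ s ∈ (g.affineHomeo k).source := by
    refine ⟨hsb ▸ hsg, ?_⟩
    rw [hsh]
    exact mul_ne_zero hd hsk
  refine ((g.affineHomeo k).left_inv hmem).symm.trans ?_
  change (g.affineHomeo k).symm _ = (g.affineHomeo k).symm (F (f.affineHomeo i s))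
  congr 1
  refine Prod.ext ?_ ?_
  · change g.chart (prolongMap D φ s).base = g.chart (φ (f.chart.symm (f.chart s.base)))
    rw [hsb, f.chart.left_inv hs.1]
  · funext j
    change g.hom (prolongMap D φ s) (k.succAbove j) / g.hom (prolongMap D φ s) k =
      A (f.affineChart i s) (k.succAbove j) / A (f.affineChart i s) k
    rw [hsh]
    exact mul_div_mul_left _ _ hd

/-- Differentiating base ∘ φ¹ = φ ∘ base shows that dφ¹ sends a vector over the line ℓ to one over
dφ(ℓ), which is invariance of the prolonged distribution. -/
lemma IsSymmetryPair.prolong_left (h : IsSymmetryPair D φ φ' U V) :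
    IsSymmetryOn D.prolong (prolongMap D φ) (prolongMap D φ')
      (Prolong.base ⁻¹' U) (Prolong.base ⁻¹' V) where
  isOpen := h.left.isOpen.preimage continuous_base
  mapsTo q hq := by
    rw [mem_preimage, (h.prolongMap_spec hq).1]
    exact h.left.mapsTo hq
  contMDiffOn q hq := (h.contMDiffAt_prolongMap hq).contMDiffWithinAt
  left_inv q hq := by
    obtain ⟨h1, h2⟩ := h.prolongMap_spec hq
    have hq' : (prolongMap D φ q).base ∈ V := by rw [h1]; exact h.left.mapsTo hq
    obtain ⟨h3, h4⟩ := h.symm.prolongMap_spec hq'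
    have h5 := h4 _ (h2 _ q.rep_mem_lineSpace)
    refine Prolong.ext_of_mem (v := q.line.rep.1) ?_ q.rep_ne_zero ?_ q.rep_mem_lineSpace
    · rw [h3, h1, h.left.left_inv _ hq]
    · rw [h1, h.mfderiv_mfderiv hq] at h5
      exact h5
  map_mem q hq w hw := by
    have h1 : Prolong.base ∘ prolongMap D φ =ᶠ[𝓝 q] φ ∘ Prolong.base := by
      filter_upwards [(h.left.isOpen.preimage continuous_base).mem_nhds hq] with s hs
        using (h.prolongMap_spec hs).1
    have h2 := h1.mfderiv_eq (I := 𝓘(ℂ, E × (Fin r → ℂ))) (I' := 𝓘(ℂ, E))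
    rw [mfderiv_comp (I' := 𝓘(ℂ, E × (Fin r → ℂ))) q
        (contMDiff_base.contMDiffAt.mdifferentiableAt (by simp))
        ((h.contMDiffAt_prolongMap hq).mdifferentiableAt (by simp)),
      mfderiv_comp (I' := 𝓘(ℂ, E)) q (h.left.mdifferentiableAt hq)
        (contMDiff_base.contMDiffAt.mdifferentiableAt (by simp))] at h2
    have h3 := congrArg (fun L : E × (Fin r → ℂ) →L[ℂ] E => L w) h2
    have h4 := (h.prolongMap_spec hq).2 _ hw
    change (mfderiv 𝓘(ℂ, E × (Fin r → ℂ)) 𝓘(ℂ, E) (Prolong.base (D := D)) (prolongMap D φ q)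
      (mfderiv 𝓘(ℂ, E × (Fin r → ℂ)) 𝓘(ℂ, E × (Fin r → ℂ)) (prolongMap D φ) q w) : E) ∈
        ((prolongMap D φ q).lineSpace : Submodule ℂ E)
    exact h3 ▸ h4

lemma IsSymmetryPair.prolong (h : IsSymmetryPair D φ φ' U V) :
    IsSymmetryPair D.prolong (prolongMap D φ) (prolongMap D φ')
      (Prolong.base ⁻¹' U) (Prolong.base ⁻¹' V) :=
  ⟨h.prolong_left, h.symm.prolong_left⟩

/-- Symmetries map prolonged curves to prolonged curves. -/
lemma IsCurveProlong.map [T2Space M] [IsManifold 𝓘(ℂ, E) ω M] (h : IsSymmetryPair D φ φ' U V)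
    {c : ℂ → M} {C : ℂ → Prolong D} (hC : IsCurveProlong D c C)
    (hc : ContMDiffAt 𝓘(ℂ, ℂ) 𝓘(ℂ, E) ω c 0) (h0 : c 0 ∈ U) :
    IsCurveProlong D (φ ∘ c) (prolongMap D φ ∘ C) := by
  have hb := (hC.base_comp_eventuallyEq hc.continuousAt).eq_of_nhds
  have hCU : (C 0).base ∈ U := by
    change (Prolong.base ∘ C) 0 ∈ U
    rwa [hb]
  rw [isCurveProlong_iff] at hC ⊢
  refine ⟨(h.contMDiffAt_prolongMap hCU).comp (0 : ℂ) hC.1, ?_⟩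
  filter_upwards [hC.2,
    (hc.continuousAt.eventually_mem (h.left.isOpen.mem_nhds h0)).filter_mono nhdsWithin_le_nhds,
    (contMDiffAt_eventually_mdifferentiableAt hc).filter_mono nhdsWithin_le_nhds]
    with t ⟨h1, h2, h3⟩ h4 h5
  rw [velocity_comp (E := E) (E' := E) (h.left.mdifferentiableAt h4) h5]
  obtain ⟨h6, h7⟩ := h.prolongMap_spec (q := C t) (h1 ▸ h4)
  refine ⟨?_, ?_, ?_⟩
  · rw [Function.comp_apply, h6, h1, Function.comp_apply]
  · intro h8
    exact h2 (h.mfderiv_injective h4 (h8.trans (map_zero _).symm))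
  · have h8 := h7 _ h3
    rw [h1] at h8
    exact h8

end General

/-! ### Projections of velocities -/

section General

variable {E : Type} [NormedAddCommGroup E] [NormedSpace ℂ E]
  {M : Type} [TopologicalSpace M] [ChartedSpace E M] {r : ℕ} {D : Distribution E M r}

/-- A curve inside a fiber projects to a constant. Hence tangency to the initial fiber of a baby
monster means verticality. -/
lemma mfderiv_base_eq_zero_of_mem_tangentSet {b : M} {q : Prolong D}
    {v : TangentSpace 𝓘(ℂ, E × (Fin r → ℂ)) q}
    (hv : v ∈ tangentSet (E := E × (Fin r → ℂ)) {s : Prolong D | s.base = b} q) :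
    mfderiv 𝓘(ℂ, E × (Fin r → ℂ)) 𝓘(ℂ, E) (Prolong.base (D := D)) q v = 0 := by
  obtain ⟨c, rfl, hc, hS, rfl⟩ := hv
  have h1 := velocity_comp (E := E × (Fin r → ℂ)) (E' := E)
    (contMDiff_base.contMDiffAt.mdifferentiableAt (by simp) :
      MDifferentiableAt 𝓘(ℂ, E × (Fin r → ℂ)) 𝓘(ℂ, E) (Prolong.base (D := D)) (c 0))
    (hc.mdifferentiableAt (by simp))
  refine h1.symm.trans ?_
  have h2 : Prolong.base ∘ c =ᶠ[𝓝 0] fun _ => b := hS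
  refine (velocity_congr h2).trans ?_
  rw [velocity, mfderiv_const]
  rfl

lemma IsCurveProlong.mfderiv_base_velocity [T2Space M] {c : ℂ → M} {C : ℂ → Prolong D}
    (h : IsCurveProlong D c C) (hc : ContinuousAt c 0) :
    (mfderiv 𝓘(ℂ, E × (Fin r → ℂ)) 𝓘(ℂ, E) (Prolong.base (D := D)) (C 0)
      (velocity (E := E × (Fin r → ℂ)) C 0) : E) = velocity (E := E) c 0 := by
  rw [← velocity_congr (h.base_comp_eventuallyEq hc)]
  exact (velocity_comp (E := E × (Fin r → ℂ)) (E' := E)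
    (contMDiff_base.contMDiffAt.mdifferentiableAt (by simp))
    (h.1.mdifferentiableAt (by simp))).symm

lemma IsCurveProlong.velocity_ne_zero [T2Space M] {c : ℂ → M} {C : ℂ → Prolong D}
    (h : IsCurveProlong D c C) (hc : ContinuousAt c 0) (h0 : (velocity (E := E) c 0 : E) ≠ 0) :
    velocity (E := E × (Fin r → ℂ)) C 0 ≠ 0 := by
  intro h1
  apply h0
  rw [← h.mfderiv_base_velocity hc, h1, map_zero]
  rfl

/-- The line of `C'` at 0 contains the velocity of `C`, and the projection of the latter is the
velocity of `c`. -/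
lemma IsCurveProlong.velocity_eq_zero_of_vertical [T2Space M]
    {c : ℂ → M} {C : ℂ → Prolong D} {C' : ℂ → Prolong D.prolong}
    (h : IsCurveProlong D c C) (h' : IsCurveProlong D.prolong C C') (hc : ContinuousAt c 0)
    (hv : (C' 0).lineSpace ≤
      (mfderiv 𝓘(ℂ, E × (Fin r → ℂ)) 𝓘(ℂ, E) (Prolong.base (D := D)) (C' 0).base).ker) :
    (velocity (E := E) c 0 : E) = 0 := by
  have h1 := hv (h'.velocity_mem h.1)
  have h2 : (C' 0).base = C 0 := (h'.base_comp_eventuallyEq h.1.continuousAt).eq_of_nhds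
  rw [← h.mfderiv_base_velocity hc]
  -- Transports the differential along `h2`, with the vector kept in the model space.
  have h3 : ∀ (s : Prolong D) (v : E × (Fin r → ℂ)), s = C 0 →
      (mfderiv 𝓘(ℂ, E × (Fin r → ℂ)) 𝓘(ℂ, E) (Prolong.base (D := D)) s v : E) = 0 →
      (mfderiv 𝓘(ℂ, E × (Fin r → ℂ)) 𝓘(ℂ, E) (Prolong.base (D := D)) (C 0) v : E) = 0 := by
    rintro _ v rfl h
    exact h
  exact h3 _ _ h2 h1

end General

variable {r : ℕ}

instance instT2SpaceP (k : ℕ) : T2Space (P r k) := by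
  induction k with
  | zero => exact inferInstanceAs (T2Space (Fin (r + 1) → ℂ))
  | succ k ih => exact inferInstanceAs (T2Space (Prolong (tower r k).dist))

/-! ### Vertical and critical points -/

lemma proj_self {k : ℕ} (p : P r k) : proj le_rfl p = p := by
  unfold proj
  rw [Nat.leRecOn_self]
  rfl

lemma proj_succ {i k : ℕ} (h : i ≤ k) (p : P r (k + 1)) :
    proj (h.trans k.le_succ) p = proj h (down p) := by
  unfold proj
  rw [Nat.leRecOn_succ h]

/-- No projection of the point is vertical. -/
def IsNonvertical : (k : ℕ) → P r k → Prop
  | 0, _ => True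
  | k + 1, q => IsNonvertical k (down q) ∧ ¬ IsVertical q

lemma IsNonvertical.not_isVertical : {k : ℕ} → {p : P r k} → IsNonvertical k p → ¬ IsVertical p
  | 0, _, _ => id
  | _ + 1, _, h => h.2

lemma IsNonvertical.proj {i : ℕ} : {k : ℕ} → (h : i ≤ k) → {p : P r k} → IsNonvertical k p →
    IsNonvertical i (proj h p) := by
  intro k h
  induction k, h using Nat.le_induction with
  | base => intro p hp; rwa [proj_self]
  | succ k h ih => intro p hp; rw [proj_succ h]; exact ih hp.1

lemma isNonvertical_iff {k : ℕ} {p : P r k} :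
    IsNonvertical k p ↔ ∀ (i : ℕ) (h : i ≤ k), ¬ IsVertical (proj h p) := by
  refine ⟨fun hp i h => (hp.proj h).not_isVertical, ?_⟩
  induction k with
  | zero => intro _; trivial
  | succ k ih =>
    intro hp
    refine ⟨ih fun i h => ?_, ?_⟩
    · rw [← proj_succ h]
      exact hp i _
    · have := hp (k + 1) le_rfl
      rwa [proj_self] at this

/-- If the baby monster is a fiber, its tangent vectors are vertical. If it is the prolongation of
`S`, belonging to it is, by construction, criticality of the point below with respect to `S`. -/
lemma IsCritical.isVertical_or {k : ℕ} {p : P r (k + 1)} (h : IsCritical p) :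
    IsVertical p ∨ IsCritical (down p) := by
  obtain ⟨S, hS, hp, hl⟩ := h
  cases hS with
  | fiber k b =>
    left
    intro v hv
    exact mfderiv_base_eq_zero_of_mem_tangentSet (D := (tower r k).dist) (hl v hv)
  | prolong k S hS =>
    right
    exact ⟨S, hS, hp⟩

/-- Criticality descends level by level until a vertical projection appears, and nothing is critical
at level 0. -/
lemma IsNonvertical.not_isCritical {k : ℕ} {p : P r k} (h : IsNonvertical k p) :
    ¬ IsCritical p := by
  induction k with
  | zero => exact id
  | succ k ih => exact fun hc => hc.isVertical_or.elim h.2 (ih h.1)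

lemma letter_eq_R_iff {k : ℕ} {p : P r k} :
    letter p = Letter.R ↔ ¬ IsVertical p ∧ ¬ IsCritical p := by
  unfold letter
  split_ifs <;> simp_all

lemma code_eq_iff {k : ℕ} {p : P r k} :
    code p = (fun _ => Letter.R) ↔ IsNonvertical k p := by
  constructor
  · intro h
    rw [isNonvertical_iff]
    intro i hi
    -- The letters start at level 1; level 0 is nonvertical by definition, and letter number `i` is
    -- read at level `i + 1`.
    cases i with
    | zero => exact id
    | succ i => exact (letter_eq_R_iff.1 (congrFun h ⟨i, hi⟩)).1
  · intro h
    funext i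
    have := h.proj (Nat.succ_le_of_lt i.isLt)
    exact letter_eq_R_iff.2 ⟨this.not_isVertical, this.not_isCritical⟩

/-! ### Prolongations of curve germs -/

lemma IsProlongation.contMDiffAt {γ : ℂ → P r 0} {k : ℕ} {Γ : ℂ → P r k}
    (h : IsProlongation γ k Γ) : ContMDiffAt 𝓘(ℂ, ℂ) 𝓘(ℂ, Model r k) ω Γ 0 := by
  cases k with
  | zero => exact h.1 ▸ h.2
  | succ k => obtain ⟨Γ', h1, h2⟩ := h; exact h2.1

lemma IsProlongation.velocity_ne_zero {γ : ℂ → P r 0} {k : ℕ} {Γ : ℂ → P r k}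
    (h : IsProlongation γ k Γ) (h0 : velocity (E := Model r 0) γ 0 ≠ 0) :
    velocity (E := Model r k) Γ 0 ≠ 0 := by
  induction k with
  | zero => obtain ⟨rfl, -⟩ := h; exact h0
  | succ k ih =>
    obtain ⟨Γ', h1, h2⟩ := h
    exact IsCurveProlong.velocity_ne_zero h2 h1.contMDiffAt.continuousAt (ih h1)

lemma IsProlongation.isNonvertical {γ : ℂ → P r 0} {k : ℕ} {Γ : ℂ → P r k}
    (h : IsProlongation γ k Γ) (h0 : velocity (E := Model r 0) γ 0 ≠ 0) :
    IsNonvertical k (Γ 0) := by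
  induction k with
  | zero => trivial
  | succ k ih =>
    obtain ⟨Γ', h1, h2⟩ := h
    have hb : down (Γ 0) = Γ' 0 :=
      (IsCurveProlong.base_comp_eventuallyEq h2 h1.contMDiffAt.continuousAt).eq_of_nhds
    refine ⟨hb ▸ ih h1, ?_⟩
    -- Level 1 is never vertical. From level 2 on, the velocity compared is that of the prolongation
    -- two levels down.
    cases k with
    | zero => exact id
    | succ k =>
      obtain ⟨Γ'', h3, h4⟩ := h1
      intro hv
      exact h3.velocity_ne_zero h0 (IsCurveProlong.velocity_eq_zero_of_vertical h4 h2
        h3.contMDiffAt.continuousAt hv)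

lemma IsProlongation.proj_zero {γ : ℂ → P r 0} {k : ℕ} {Γ : ℂ → P r k}
    (h : IsProlongation γ k Γ) : Monster.proj (Nat.zero_le k) (Γ 0) = γ 0 := by
  induction k with
  | zero => obtain ⟨rfl, -⟩ := h; exact proj_self _
  | succ k ih =>
    obtain ⟨Γ', h1, h2⟩ := h
    have hb : down (Γ 0) = Γ' 0 :=
      (IsCurveProlong.base_comp_eventuallyEq h2 h1.contMDiffAt.continuousAt).eq_of_nhds
    rw [proj_succ (Nat.zero_le k), hb, ih h1]

lemma IsProlongation.eventuallyEq {γ : ℂ → P r 0} {k : ℕ} {Γ Γ' : ℂ → P r k}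
    (h : IsProlongation γ k Γ) (h' : IsProlongation γ k Γ') : Γ =ᶠ[𝓝 0] Γ' := by
  induction k with
  | zero => rw [h.1, h'.1]
  | succ k ih =>
    obtain ⟨G, h1, h2⟩ := h
    obtain ⟨G', h1', h2'⟩ := h'
    exact IsCurveProlong.eventuallyEq h2 h2' (ih h1 h1')

/-! ### Jet charts -/

/-- The standard chart of `ℂⁿ`, with the constant frame whose first vector is the `i`-th one. -/
def flatChart (r : ℕ) (i : Fin (r + 1)) : FrameChart r (flat r).space where
  chart := OpenPartialHomeomorph.refl _
  frame _ := ContinuousLinearMap.pi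
    (i.insertNth (ContinuousLinearMap.proj 0) fun j => ContinuousLinearMap.proj j.succ)
  coframe _ := ContinuousLinearMap.pi
    (Fin.cons (ContinuousLinearMap.proj i) fun j => ContinuousLinearMap.proj (i.succAbove j))
  mem_maximalAtlas := IsManifold.subset_maximalAtlas (by simp)
  contDiffOn_frame := contDiffOn_const
  contDiffOn_coframe := contDiffOn_const
  coframe_frame := by
    intro x _ a
    funext j
    refine Fin.cases ?_ (fun j => ?_) j <;> simp
  mem_iff := by
    refine fun p _ v => ⟨fun _ => ⟨Fin.cons (v i) fun j => v (i.succAbove j), ?_⟩,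
      fun _ => Submodule.mem_top⟩
    have h : mfderiv 𝓘(ℂ, Fin (r + 1) → ℂ) 𝓘(ℂ, Fin (r + 1) → ℂ)
      (OpenPartialHomeomorph.refl (Fin (r + 1) → ℂ)) p v = v := by
      change mfderiv 𝓘(ℂ, Fin (r + 1) → ℂ) 𝓘(ℂ, Fin (r + 1) → ℂ) id p v = v
      rw [mfderiv_id]
      rfl
    rw [h]
    funext j
    refine Fin.succAboveCases i ?_ (fun j => ?_) j <;> simp

lemma flatChart_frame (i : Fin (r + 1)) (x : Fin (r + 1) → ℂ) (a : Fin (r + 1) → ℂ) :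
    (flatChart r i).frame x a = i.insertNth (a 0) fun j => a j.succ := by
  funext j
  refine Fin.succAboveCases i ?_ (fun j => ?_) j <;> simp [flatChart]

lemma flatChart_hom (i : Fin (r + 1)) (q : Prolong (flat r)) :
    FrameChart.hom (D := flat r) (flatChart r i) q 0 =
      (show Fin (r + 1) → ℂ from (q.line.rep.1 : TangentSpace 𝓘(ℂ, Fin (r + 1) → ℂ) q.base)) i := by
  change (mfderiv 𝓘(ℂ, Fin (r + 1) → ℂ) 𝓘(ℂ, Fin (r + 1) → ℂ)
    (id : (Fin (r + 1) → ℂ) → (Fin (r + 1) → ℂ)) q.base q.line.rep.1 : Fin (r + 1) → ℂ) i = _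
  rw [mfderiv_id]
  rfl

/-- The jet charts of the tower. -/
def jetChart (r : ℕ) (i : Fin (r + 1)) : (k : ℕ) → FrameChart r (tower r k).dist.space
  | 0 => flatChart r i
  -- Index 0 means nonzero `i`-th component of the direction for the passage to level 1, and
  -- nonvertical direction at all later levels.
  | k + 1 => FrameChart.prolongChart (D := (tower r k).dist) (jetChart r i k) 0

/-- The charts fill the whole model space, so every choice of coordinates is the jet of some point.
-/
lemma jetChart_target (i : Fin (r + 1)) (k : ℕ) (y : Model r k) :
    y ∈ (jetChart r i k).chart.target := by
  induction k with
  | zero => exact mem_univ _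
  | succ k ih => exact ih y.1

/-- A line in ℂⁿ has some nonzero component `i`, which fixes x. Above level 1 the chart loses
exactly the vertical lines, so `i` never has to change. -/
lemma isNonvertical_iff_exists_jetChart {k : ℕ} {q : P r k} :
    IsNonvertical k q ↔ ∃ i, q ∈ (jetChart r i k).chart.source := by
  have hstep : ∀ (i : Fin (r + 1)) (k : ℕ) (q : P r (k + 2)),
      down q ∈ (jetChart r i (k + 1)).chart.source →
        (q ∈ (jetChart r i (k + 2)).chart.source ↔ ¬ IsVertical q) := fun i k q hd =>
    (and_iff_right hd).trans (not_congr
      (FrameChart.vertical_iff (D := (tower r k).dist) (jetChart r i k) 0 (q := q) hd)).symm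
  constructor
  · induction k with
    | zero => exact fun _ => ⟨0, mem_univ _⟩
    | succ k ih =>
      cases k with
      | zero =>
        intro _
        have h0 := Prolong.rep_ne_zero (D := flat r) q
        obtain ⟨i, hi⟩ := Function.ne_iff.1 h0
        exact ⟨i, mem_univ _, fun h => hi ((flatChart_hom i q).symm.trans h)⟩
      | succ k =>
        intro h
        obtain ⟨i, hi⟩ := ih h.1
        exact ⟨i, (hstep i k q hi).2 h.2⟩
  · rintro ⟨i, hi⟩
    induction k with
    | zero => trivial
    | succ k ih =>
      refine ⟨ih hi.1, ?_⟩
      cases k with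
      | zero => exact id
      | succ k => exact (hstep i k q hi.1).1 hi

/-! ### Jets of curves -/

/-- The jet of the curve `x = x₀ + t`, `u = U 0 t`, where `U j` is the `j`-th derivative of `U 0`. -/
def jetCurve (i : Fin (r + 1)) (x₀ : ℂ) (U : ℕ → ℂ → Fin r → ℂ) : (k : ℕ) → ℂ → Model r k
  | 0 => fun t => (i.insertNth (x₀ + t) (U 0 t) : Fin (r + 1) → ℂ)
  | k + 1 => fun t => (jetCurve i x₀ U k t, U (k + 1) t)

section JetCurve

variable {i : Fin (r + 1)} {x₀ : ℂ} {U : ℕ → ℂ → Fin r → ℂ}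

lemma hasDerivAt_insertNth {u : ℂ → Fin r → ℂ} {u' : Fin r → ℂ} {t : ℂ}
    (hu : HasDerivAt u u' t) :
    HasDerivAt (fun s => (i.insertNth (x₀ + s) (u s) : Fin (r + 1) → ℂ)) (i.insertNth 1 u') t := by
  rw [hasDerivAt_pi]
  intro j
  refine Fin.succAboveCases i ?_ (fun j => ?_) j
  · simpa using (hasDerivAt_id t).const_add x₀
  · simpa using hasDerivAt_pi.1 hu j

/-- Component 0 of the velocity is dx/dt = 1, so the direction is already normalized as in the
affine chart of index 0, and its fiber coordinate at the next level is `U (k + 1)`. -/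
lemma hasDerivAt_jetCurve (hU : ∀ j t, HasDerivAt (U j) (U (j + 1) t) t) (k : ℕ) (t : ℂ) :
    HasDerivAt (jetCurve i x₀ U k)
      ((jetChart r i k).frame (jetCurve i x₀ U k t) (Fin.cons 1 (U (k + 1) t))) t := by
  induction k with
  | zero =>
    have h1 := hasDerivAt_insertNth (i := i) (x₀ := x₀) (hU 0 t)
    have h2 := flatChart_frame i (i.insertNth (x₀ + t) (U 0 t)) (Fin.cons 1 (U 1 t))
    simp only [Fin.cons_zero, Fin.cons_succ] at h2
    rw [← h2] at h1
    exact h1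
  | succ k ih =>
    have h1 := ih.prodMk (hU (k + 1) t)
    refine h1.congr_deriv ?_
    refine Prod.ext ?_ ?_
    · change _ = (Fin.cons (1 : ℂ) (U (k + 2) t) : Fin (r + 1) → ℂ) 0 •
        (jetChart r i k).frame (jetCurve i x₀ U k t) ((0 : Fin (r + 1)).insertNth 1 (U (k + 1) t))
      simp
    · funext j
      rfl

lemma contDiff_jetCurve (hU : ∀ j t, HasDerivAt (U j) (U (j + 1) t) t) (k : ℕ) :
    ContDiff ℂ ω (jetCurve i x₀ U k) := by
  have hd : ∀ j, ContDiff ℂ ω (U j) := fun j =>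
    Differentiable.contDiff fun t => (hU j t).differentiableAt
  induction k with
  | zero =>
    refine contDiff_pi.2 fun j => ?_
    refine Fin.succAboveCases i ?_ (fun j => ?_) j
    · simpa [jetCurve] using contDiff_const.add contDiff_id
    · simpa [jetCurve] using contDiff_pi.1 (hd 0) j
  | succ k ih => exact ih.prodMk (hd (k + 1))

lemma isProlongation_jetCurve (hU : ∀ j t, HasDerivAt (U j) (U (j + 1) t) t) (k : ℕ) :
    IsProlongation (r := r) (jetCurve i x₀ U 0) k
      ((jetChart r i k).chart.symm ∘ jetCurve i x₀ U k) := by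
  induction k with
  | zero => exact ⟨rfl, (contDiff_jetCurve hU 0).contMDiff.contMDiffAt⟩
  | succ k ih =>
    refine ⟨_, ih, ?_⟩
    refine isCurveProlong_chart (D := (tower r k).dist) (jetChart r i k) 0 (contDiff_jetCurve hU k)
      (w := U (k + 1)) ?_ (fun t => jetChart_target i k _) fun t => ?_
    · exact Differentiable.contDiff fun t => (hU _ t).differentiableAt
    · rw [(hasDerivAt_jetCurve hU k t).deriv, Fin.insertNth_zero']

lemma velocity_jetCurve_ne_zero (hU : ∀ j t, HasDerivAt (U j) (U (j + 1) t) t) {γ : ℂ → P r 0}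
    (hγ : γ = jetCurve i x₀ U 0) : velocity (E := Model r 0) γ 0 ≠ 0 := by
  subst hγ
  have h := hasDerivAt_insertNth (i := i) (x₀ := x₀) (hU 0 0)
  intro h2
  have h3 : mfderiv 𝓘(ℂ, ℂ) 𝓘(ℂ, Fin (r + 1) → ℂ)
      (fun s => (i.insertNth (x₀ + s) (U 0 s) : Fin (r + 1) → ℂ)) 0 (1 : ℂ) =
        (0 : Fin (r + 1) → ℂ) := h2
  rw [mfderiv_eq_fderiv] at h3
  have h4 := h.deriv.symm.trans h3
  have h5 := congrFun h4 i
  simp at h5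

end JetCurve

lemma exists_jetCurve_eq (i : Fin (r + 1)) (k : ℕ) (y : Model r k) :
    ∃ (x₀ : ℂ) (U : ℕ → ℂ → Fin r → ℂ), (∀ j t, HasDerivAt (U j) (U (j + 1) t) t) ∧
      jetCurve i x₀ U k 0 = y := by
  -- The coordinates of `y` amount to x₀ and the values at 0 of the derivatives of order at most
  -- `k`.
  have h1 : ∃ (x₀ : ℂ) (u : ℕ → Fin r → ℂ), ∀ U : ℕ → ℂ → Fin r → ℂ,
      (∀ j ≤ k, U j 0 = u j) → jetCurve i x₀ U k 0 = y := by
    induction k with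
    | zero =>
      refine ⟨(y : Fin (r + 1) → ℂ) i, fun _ j => (y : Fin (r + 1) → ℂ) (i.succAbove j),
        fun U hU => ?_⟩
      funext j
      refine Fin.succAboveCases i ?_ (fun j => ?_) j
      · simp [jetCurve]
      · simp [jetCurve, hU 0 le_rfl]
    | succ k ih =>
      obtain ⟨x₀, u, h⟩ := ih (Prod.fst (β := Fin r → ℂ) y)
      refine ⟨x₀, fun j => if j = k + 1 then Prod.snd (α := Model r k) y else u j, fun U hU => Prod.ext ?_ ?_⟩
      · refine h U fun j hj => (hU j (by omega)).trans ?_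
        exact if_neg (by omega)
      · exact (hU (k + 1) le_rfl).trans (if_pos rfl)
  obtain ⟨x₀, u, h⟩ := h1
  -- The Taylor polynomial with j-th derivative `u j` at 0, whence the factorials.
  let p : Fin r → Polynomial ℂ := fun a =>
    ∑ m ∈ Finset.range (k + 1), Polynomial.monomial m (u m a / (m.factorial : ℂ))
  refine ⟨x₀, fun j t a => (Polynomial.derivative^[j] (p a)).eval t, fun j t => ?_,
    h _ fun j hj => ?_⟩
  · refine hasDerivAt_pi.2 fun a => ?_
    simp only [Function.iterate_succ_apply']
    exact Polynomial.hasDerivAt _ _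
  · funext a
    have hj' : j < k + 1 := by omega
    have h2 : (p a).coeff j = u j a / (j.factorial : ℂ) := by
      simp [p, Polynomial.coeff_monomial, hj']
    rw [← Polynomial.coeff_zero_eq_eval_zero, Polynomial.coeff_iterate_derivative, zero_add, h2,
      Nat.descFactorial_self, nsmul_eq_mul]
    exact mul_div_cancel₀ _ (Nat.cast_ne_zero.2 j.factorial_ne_zero)

lemma IsNonvertical.exists_jetCurve {k : ℕ} {p : P r k} (h : IsNonvertical k p) :
    ∃ (i : Fin (r + 1)) (x₀ : ℂ) (U : ℕ → ℂ → Fin r → ℂ),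
      (∀ j t, HasDerivAt (U j) (U (j + 1) t) t) ∧
      ((jetChart r i k).chart.symm ∘ jetCurve i x₀ U k) 0 = p := by
  obtain ⟨i, hi⟩ := isNonvertical_iff_exists_jetChart.1 h
  obtain ⟨x₀, U, hU, e⟩ := exists_jetCurve_eq i k ((jetChart r i k).chart p)
  refine ⟨i, x₀, U, hU, ?_⟩
  rw [Function.comp_apply, e, (jetChart r i k).chart.left_inv hi]

/-! ### Cartan points are the nonvertical points -/

lemma isCartan_iff {k : ℕ} {p : P r k} : IsCartan p ↔ IsNonvertical k p := by
  constructor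
  · rintro ⟨γ, h0, Γ, h1, rfl, -⟩
    exact h1.isNonvertical h0
  · intro h
    obtain ⟨i, x₀, U, hU, e⟩ := h.exists_jetCurve
    exact ⟨_, velocity_jetCurve_ne_zero hU rfl, _, isProlongation_jetCurve hU k, e,
      (isProlongation_jetCurve hU k).velocity_ne_zero (velocity_jetCurve_ne_zero hU rfl)⟩

section General

variable {E : Type} [NormedAddCommGroup E] [NormedSpace ℂ E]
  {M : Type} [TopologicalSpace M] [ChartedSpace E M] {r : ℕ} {D : Distribution E M r}

/-! ### Hypersurfaces -/

lemma isHypersurface_empty : IsHypersurface E (∅ : Set M) := fun p =>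
  ⟨univ, fun _ => 1, isOpen_univ, mem_univ p, contMDiffOn_const,
    fun _ _ _ hV => hV.imp fun _ hx => ⟨hx, one_ne_zero⟩, by simp⟩

lemma IsHypersurface.isClosed {S : Set M} (h : IsHypersurface E S) : IsClosed S := by
  rw [← isOpen_compl_iff, isOpen_iff_mem_nhds]
  intro p hp
  obtain ⟨U, f, hU, hpU, hf, -, e⟩ := h p
  have hfp : f p ≠ 0 := fun h0 => hp (e.superset ⟨hpU, h0⟩).1
  filter_upwards [hU.mem_nhds hpU,
    (hf.continuousOn.continuousAt (hU.mem_nhds hpU)).eventually_ne hfp] with q hq hq0 hqS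
  exact hq0 (e.subset ⟨hqS, hq⟩).2

lemma IsHypersurface.dense_compl {S : Set M} (h : IsHypersurface E S) : Dense Sᶜ := by
  rw [← interior_eq_empty_iff_dense_compl, ← not_nonempty_iff_eq_empty]
  rintro ⟨p, hp⟩
  obtain ⟨U, f, hU, hpU, -, hf, e⟩ := h p
  obtain ⟨x, hx, hx0⟩ := hf (U ∩ interior S) inter_subset_left (hU.inter isOpen_interior)
    ⟨p, hpU, hp⟩
  exact hx0 (e.subset ⟨interior_subset hx.2, hx.1⟩).2

/-- The entry is the constant 1 if j = m, and otherwise a coordinate function, which is open and so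
not identically zero on `V`. -/
lemma exists_insertNth_apply_ne_zero {X : Type} [TopologicalSpace X] (m j : Fin (r + 1))
    {V : Set (X × (Fin r → ℂ))}
    (hV : IsOpen V) (hne : V.Nonempty) :
    ∃ y ∈ V, (m.insertNth (1 : ℂ) y.2 : Fin (r + 1) → ℂ) j ≠ 0 := by
  induction j using Fin.succAboveCases m with
  | x => exact hne.imp fun y hy => ⟨hy, by simp⟩
  | p b =>
    have ho : IsOpenMap fun y : X × (Fin r → ℂ) => y.2 b :=
      (isOpenMap_eval b).comp isOpenMap_snd
    obtain ⟨_, ⟨y, hy, rfl⟩, h0⟩ := (dense_compl_singleton (0 : ℂ)).inter_open_nonempty _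
      (ho V hV) (hne.image _)
    exact ⟨y, hy, by simpa using h0⟩

/-- The lines over a hypersurface, together with the vertical lines, form a hypersurface. -/
lemma IsHypersurface.prolong {S : Set (Prolong D)} (h : IsHypersurface (E × (Fin r → ℂ)) S) :
    IsHypersurface ((E × (Fin r → ℂ)) × (Fin r → ℂ)) {q : Prolong D.prolong | q.base ∈ S ∨
      q.lineSpace ≤
        (mfderiv 𝓘(ℂ, E × (Fin r → ℂ)) 𝓘(ℂ, E) (Prolong.base (D := D)) q.base).ker} := by
  intro p
  obtain ⟨f, i, hf⟩ := exists_affineChart p.base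
  let g : FrameChart r D.prolong.space := f.prolongChart i
  obtain ⟨m, hm⟩ := Function.ne_iff.1 (g.hom_ne_zero (q := p) hf)
  obtain ⟨U, φ, hU, hpU, hφ, hφne, e⟩ := h p.base
  -- The ratio of homogeneous coordinates 0 and `m`, an equation of the vertical lines in this
  -- chart. For m = 0 it is 1, and the chart has no vertical line.
  let A : (E × (Fin r → ℂ)) × (Fin r → ℂ) → ℂ := fun y => (m.insertNth (1 : ℂ) y.2 : _ → ℂ) 0
  have hA : ContDiff ℂ ω A :=
    contDiff_pi.1 ((FrameChart.contDiff_insertNth m).comp contDiff_snd) 0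
  let a : Prolong D.prolong → ℂ := A ∘ g.affineHomeo m
  have hs : IsOpen ((g.affineHomeo m).source) := (g.affineHomeo m).open_source
  have ha : ContMDiffOn 𝓘(ℂ, (E × (Fin r → ℂ)) × (Fin r → ℂ)) 𝓘(ℂ, ℂ) ω a
      (g.affineHomeo m).source :=
    hA.contMDiff.comp_contMDiffOn (contMDiffOn_of_mem_maximalAtlas (g.affineHomeo_mem m))
  have ha0 : ∀ q ∈ (g.affineHomeo m).source, a q = 0 ↔ q.lineSpace ≤
      (mfderiv 𝓘(ℂ, E × (Fin r → ℂ)) 𝓘(ℂ, E) (Prolong.base (D := D)) q.base).ker := by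
    intro q hq
    rw [f.vertical_iff i hq.1]
    have hqm : g.hom q m ≠ 0 := hq.2
    have e1 : a q = g.hom q 0 / g.hom q m := by
      change (m.insertNth (1 : ℂ) (fun j => g.hom q (m.succAbove j) / g.hom q m) :
        Fin (r + 1) → ℂ) 0 = _
      generalize (0 : Fin (r + 1)) = j
      refine Fin.succAboveCases m ?_ (fun j => ?_) j
      · simp [hqm]
      · simp
    rw [e1, div_eq_zero_iff, or_iff_left hqm]
  refine ⟨Prolong.base ⁻¹' U ∩ (g.affineHomeo m).source, fun q => φ q.base * a q,
    (hU.preimage continuous_base).inter hs, ⟨hpU, hf, hm⟩, ?_, ?_, ?_⟩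
  · have h1 : ContMDiffOn 𝓘(ℂ, (E × (Fin r → ℂ)) × (Fin r → ℂ)) 𝓘(ℂ, ℂ) ω
        (φ ∘ Prolong.base) (Prolong.base ⁻¹' U ∩ (g.affineHomeo m).source) :=
      hφ.comp contMDiff_base.contMDiffOn inter_subset_left
    exact h1.smul (ha.mono inter_subset_right)
  · intro V hV hVo hVne
    -- To make both factors nonzero at one point, `V` is first shrunk to the open set where the
    -- pulled back factor is nonzero, and the second factor is tested there.
    obtain ⟨_, ⟨q₀, hq₀, rfl⟩, h0⟩ := hφne (Prolong.base '' V)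
      (image_subset_iff.2 fun q hq => (hV hq).1) (isOpenMap_base V hVo) (hVne.image _)
    have hW : IsOpen (V ∩ (φ ∘ Prolong.base) ⁻¹' {0}ᶜ) := by
      refine ContinuousOn.isOpen_inter_preimage ?_ hVo isOpen_compl_singleton
      exact hφ.continuousOn.comp continuous_base.continuousOn fun q hq => (hV hq).1
    have hWne : (V ∩ (φ ∘ Prolong.base) ⁻¹' {0}ᶜ).Nonempty := ⟨q₀, hq₀, h0⟩
    obtain ⟨_, ⟨q, hq, rfl⟩, h1⟩ := exists_insertNth_apply_ne_zero m 0
      ((g.affineHomeo m).isOpen_image_of_subset_source hW fun q hq => (hV hq.1).2)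
      (hWne.image _)
    exact ⟨q, hq.1, mul_ne_zero hq.2 h1⟩
  · ext q
    have e2 : ∀ s ∈ U, s ∈ S ↔ φ s = 0 := fun s hs =>
      ⟨fun h => (e.subset ⟨h, hs⟩).2, fun h => (e.superset ⟨hs, h⟩).1⟩
    constructor
    · rintro ⟨h1, h2⟩
      refine ⟨h2, mul_eq_zero.2 ?_⟩
      exact h1.imp (e2 _ h2.1).1 (ha0 q h2.2).2
    · rintro ⟨h2, h1⟩
      exact ⟨(mul_eq_zero.1 h1).imp (e2 _ h2.1).2 (ha0 q h2.2).1, h2⟩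

end General

lemma isHypersurface_not_isNonvertical (k : ℕ) :
    IsHypersurface (Model r k) {p : P r k | ¬ IsNonvertical k p} := by
  induction k with
  | zero =>
    convert! isHypersurface_empty (E := Model r 0) (M := P r 0) using 1
    exact eq_empty_of_forall_notMem fun p hp => hp trivial
  | succ k ih =>
    cases k with
    | zero =>
      convert! isHypersurface_empty (E := Model r 1) (M := P r 1) using 1
      exact eq_empty_of_forall_notMem fun p hp => hp ⟨trivial, id⟩
    | succ k =>
      have h := IsHypersurface.prolong (D := (tower r k).dist) ih
      convert! h using 1
      ext q
      change ¬ (IsNonvertical (k + 1) (down q) ∧ ¬ IsVertical q) ↔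
        ¬ IsNonvertical (k + 1) (down q) ∨ IsVertical q
      tauto

lemma cartanSet_compl (k : ℕ) : (cartanSet r k)ᶜ = {p : P r k | ¬ IsNonvertical k p} := by
  ext p
  exact not_congr isCartan_iff

lemma exists_not_isNonvertical (hr : 1 ≤ r) (k : ℕ) :
    ∃ p : P r (k + 2), ¬ IsNonvertical (k + 2) p := by
  induction k with
  | zero =>
    let f : FrameChart r (tower r 1).dist.space := jetChart r 0 1
    let j : Fin r := ⟨0, hr⟩
    let y : Model r 1 := 0
    have hy : y ∈ f.chart.target := jetChart_target 0 1 y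
    -- A frame vector of positive index is a fiber direction, so its line is vertical. Such an index
    -- exists because r ≥ 1.
    have ha : (Pi.single j.succ 1 : Fin (r + 1) → ℂ) ≠ 0 := by simp
    obtain ⟨c, -, h⟩ := FrameChart.exists_hom_lineOf_self (D := (tower r 1).dist) f hy ha
    let q : Prolong (tower r 1).dist := ⟨f.chart.symm y,
      FrameChart.lineOf (D := (tower r 1).dist) f y (Pi.single j.succ 1)⟩
    refine ⟨q, fun hq => hq.2 ?_⟩
    refine (FrameChart.vertical_iff (D := (tower r 0).dist) (jetChart r 0 0) 0 (q := q)
      (f.chart.map_target hy)).2 ?_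
    refine (congrFun h 0).trans ?_
    simp [Fin.succ_ne_zero]
  | succ k ih =>
    obtain ⟨p, hp⟩ := ih
    obtain ⟨q, rfl⟩ := surjective_base (D := (tower r (k + 2)).dist) p
    exact ⟨q, fun h => hp h.1⟩

/-! ### The action of local diffeomorphisms -/

section Action

variable {ψ : OpenPartialHomeomorph (P r 0) (P r 0)}

/-- Every local diffeomorphism preserves the full tangent bundle at level 0. Prolongation keeps
whole preimages as domains, so nothing shrinks with `k`. -/
lemma isSymmetryPair_prolongDiffeo
    (h : ContMDiffOn 𝓘(ℂ, Model r 0) 𝓘(ℂ, Model r 0) ω ψ ψ.source)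
    (h' : ContMDiffOn 𝓘(ℂ, Model r 0) 𝓘(ℂ, Model r 0) ω ψ.symm ψ.target) (k : ℕ) :
    IsSymmetryPair (tower r k).dist (prolongDiffeo ψ k) (prolongDiffeo ψ.symm k)
      (proj (Nat.zero_le k) ⁻¹' ψ.source) (proj (Nat.zero_le k) ⁻¹' ψ.target) := by
  induction k with
  | zero =>
    have e : (proj (Nat.zero_le 0) : P r 0 → P r 0) = id := funext proj_self
    rw [e]
    exact ⟨⟨ψ.open_source, ψ.mapsTo, h, fun p hp => ψ.left_inv hp, fun _ _ _ _ => trivial⟩,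
      ⟨ψ.open_target, ψ.mapsTo_symm, h', fun p hp => ψ.right_inv hp, fun _ _ _ _ => trivial⟩⟩
  | succ k ih =>
    have e : (proj (Nat.zero_le (k + 1)) : P r (k + 1) → P r 0) =
        proj (Nat.zero_le k) ∘ down := funext (proj_succ (Nat.zero_le k))
    rw [e]
    exact ih.prolong

lemma IsProlongation.map (h : ContMDiffOn 𝓘(ℂ, Model r 0) 𝓘(ℂ, Model r 0) ω ψ ψ.source)
    (h' : ContMDiffOn 𝓘(ℂ, Model r 0) 𝓘(ℂ, Model r 0) ω ψ.symm ψ.target)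
    {γ : ℂ → P r 0} (h0 : γ 0 ∈ ψ.source) {k : ℕ} {Γ : ℂ → P r k} (hΓ : IsProlongation γ k Γ) :
    IsProlongation (ψ ∘ γ) k (prolongDiffeo ψ k ∘ Γ) := by
  induction k with
  | zero =>
    obtain ⟨rfl, h1⟩ := hΓ
    exact ⟨rfl, (h.contMDiffAt (ψ.open_source.mem_nhds h0)).comp (0 : ℂ) h1⟩
  | succ k ih =>
    obtain ⟨Γ', h1, h2⟩ := hΓ
    refine ⟨_, ih h1, ?_⟩
    refine IsCurveProlong.map (isSymmetryPair_prolongDiffeo h h' k) h2 h1.contMDiffAt ?_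
    rw [mem_preimage, h1.proj_zero]
    exact h0

lemma velocity_comp_ne_zero (h : ContMDiffOn 𝓘(ℂ, Model r 0) 𝓘(ℂ, Model r 0) ω ψ ψ.source)
    (h' : ContMDiffOn 𝓘(ℂ, Model r 0) 𝓘(ℂ, Model r 0) ω ψ.symm ψ.target)
    {γ : ℂ → P r 0} (h0 : γ 0 ∈ ψ.source)
    (hγ : MDifferentiableAt 𝓘(ℂ, ℂ) 𝓘(ℂ, Model r 0) γ 0)
    (hv : velocity (E := Model r 0) γ 0 ≠ 0) : velocity (E := Model r 0) (ψ ∘ γ) 0 ≠ 0 := by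
  have hs := isSymmetryPair_prolongDiffeo h h' 0
  have h1 : γ 0 ∈ proj (Nat.zero_le 0) ⁻¹' ψ.source := by
    rw [mem_preimage, proj_self]
    exact h0
  intro h2
  have h3 := (velocity_comp (E := Model r 0) (E' := Model r 0)
    (hs.left.mdifferentiableAt h1) hγ).symm.trans h2
  exact hv (hs.mfderiv_injective h1 (h3.trans (map_zero _).symm))

end Action

/-- The shear which maps the curve `t ↦ (t, 0)` to the curve `x = x₀ + t`, `u = V t`. -/
def shear (i : Fin (r + 1)) (x₀ : ℂ) (V : ℂ → Fin r → ℂ) :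
    (Fin (r + 1) → ℂ) ≃ (Fin (r + 1) → ℂ) where
  toFun z := i.insertNth (x₀ + z 0) fun j => z j.succ + V (z 0) j
  invFun w := Fin.cons (w i - x₀) fun j => w (i.succAbove j) - V (w i - x₀) j
  left_inv z := by
    funext j
    refine Fin.cases ?_ (fun j => ?_) j <;> simp
  right_inv w := by
    funext j
    refine Fin.succAboveCases i ?_ (fun j => ?_) j <;> simp

section Shear

variable {i : Fin (r + 1)} {x₀ : ℂ} {V : ℂ → Fin r → ℂ}

lemma contDiff_shear (hV : ContDiff ℂ ω V) : ContDiff ℂ ω (shear i x₀ V) := by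
  have h0 : ContDiff ℂ ω fun z : Fin (r + 1) → ℂ => z 0 := contDiff_apply ℂ ℂ 0
  refine contDiff_pi.2 fun j => ?_
  refine Fin.succAboveCases i ?_ (fun j => ?_) j
  · simpa [shear] using contDiff_const.add h0
  · simpa [shear] using (contDiff_apply ℂ ℂ j.succ).add (contDiff_pi.1 (hV.comp h0) j)

lemma contDiff_shear_symm (hV : ContDiff ℂ ω V) : ContDiff ℂ ω (shear i x₀ V).symm := by
  have h0 : ContDiff ℂ ω fun z : Fin (r + 1) → ℂ => z i - x₀ :=
    (contDiff_apply ℂ ℂ i).sub contDiff_const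
  refine contDiff_pi.2 fun j => ?_
  refine Fin.cases ?_ (fun j => ?_) j
  · simpa [shear] using h0
  · simpa [shear] using (contDiff_apply ℂ ℂ (i.succAbove j)).sub (contDiff_pi.1 (hV.comp h0) j)

lemma shear_comp_jetCurve {U : ℕ → ℂ → Fin r → ℂ} :
    shear i x₀ (U 0) ∘ jetCurve (0 : Fin (r + 1)) 0 (fun _ _ => 0) 0 = jetCurve i x₀ U 0 := by
  funext t
  change shear i x₀ (U 0) ((0 : Fin (r + 1)).insertNth (0 + t) (0 : Fin r → ℂ)) =
    i.insertNth (x₀ + t) (U 0 t)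
  simp [shear]

end Shear

/-- The reference point is the `k`-jet of the zero function. A shear carries its graph to the graph
through any Cartan point, and uniqueness of prolongations matches the points; conversely, the image
of the immersed reference curve is immersed. -/
lemma exists_cartanSet_eq_orbit (r k : ℕ) :
    ∃ p : P r k, cartanSet r k = {q | Equivalent p q} := by
  have hU₀ : ∀ (_ : ℕ) (t : ℂ), HasDerivAt (fun _ => 0 : ℂ → Fin r → ℂ) 0 t :=
    fun _ t => hasDerivAt_const t 0
  have hΓ₀ := isProlongation_jetCurve (i := (0 : Fin (r + 1))) (x₀ := 0) (U := fun _ _ => 0) hU₀ k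
  refine ⟨((jetChart r 0 k).chart.symm ∘ jetCurve 0 0 (fun _ _ => 0) k) 0,
    Subset.antisymm (fun q hq => ?_) (fun q hq => ?_)⟩
  · obtain ⟨i, x₀, U, hU, rfl⟩ := (isCartan_iff.1 hq).exists_jetCurve
    have hV : ContDiff ℂ ω (U 0) := Differentiable.contDiff fun t => (hU 0 t).differentiableAt
    let ψ : OpenPartialHomeomorph (P r 0) (P r 0) := Homeomorph.toOpenPartialHomeomorph
      ⟨shear i x₀ (U 0), (contDiff_shear hV).continuous, (contDiff_shear_symm hV).continuous⟩
    have h : ContMDiffOn 𝓘(ℂ, Model r 0) 𝓘(ℂ, Model r 0) ω ψ ψ.source :=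
      (contDiff_shear hV).contMDiff.contMDiffOn
    have h' : ContMDiffOn 𝓘(ℂ, Model r 0) 𝓘(ℂ, Model r 0) ω ψ.symm ψ.target :=
      (contDiff_shear_symm hV).contMDiff.contMDiffOn
    have h1 := IsProlongation.map h h' (mem_univ _) hΓ₀
    have h2 : ψ ∘ jetCurve (0 : Fin (r + 1)) 0 (fun _ _ => 0) 0 = jetCurve i x₀ U 0 :=
      shear_comp_jetCurve
    rw [h2] at h1
    exact ⟨ψ, h, h', mem_univ _, (h1.eventuallyEq (isProlongation_jetCurve hU k)).eq_of_nhds⟩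
  · obtain ⟨ψ, h, h', h0, rfl⟩ := hq
    rw [hΓ₀.proj_zero] at h0
    have h1 := IsProlongation.map h h' h0 hΓ₀
    refine isCartan_iff.2 (h1.isNonvertical (velocity_comp_ne_zero h h' h0 ?_
      (velocity_jetCurve_ne_zero hU₀ rfl)))
    exact (contDiff_jetCurve hU₀ 0).contMDiff.contMDiffAt.mdifferentiableAt (by simp)

/-! ### Jet coordinates -/

/-- The coordinates `(x, u₀)` of `ℂⁿ` where `x` is the `i`-th one. -/
def flatEquiv (i : Fin (r + 1)) : (Fin (r + 1) → ℂ) ≃ₗ[ℂ] JetSpace r 0 where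
  toFun z := (z i, fun _ j => z (i.succAbove j))
  invFun w := i.insertNth w.1 (w.2 0)
  map_add' _ _ := rfl
  map_smul' _ _ := rfl
  left_inv z := by
    funext j
    refine Fin.succAboveCases i ?_ (fun j => ?_) j <;> simp
  right_inv w := by
    refine Prod.ext (by simp) ?_
    funext l j
    rw [Fin.fin_one_eq_zero l]
    simp

/-- Jets of order `k + 1` are jets of order `k` together with a derivative of order `k + 1`. -/
def jetSnocEquiv (r k : ℕ) : (JetSpace r k × (Fin r → ℂ)) ≃ₗ[ℂ] JetSpace r (k + 1) where
  toFun z := (z.1.1, Fin.snoc (α := fun _ => Fin r → ℂ) z.1.2 z.2)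
  invFun w := ((w.1, fun j => w.2 j.castSucc), w.2 (Fin.last _))
  map_add' z w := by
    refine Prod.ext rfl ?_
    funext j
    refine Fin.lastCases ?_ (fun j => ?_) j <;> simp
  map_smul' c z := by
    refine Prod.ext rfl ?_
    funext j
    refine Fin.lastCases ?_ (fun j => ?_) j <;> simp
  left_inv z := by simp
  right_inv w := by
    refine Prod.ext rfl ?_
    funext j
    refine Fin.lastCases ?_ (fun j => ?_) j <;> simp

/-- The linear change from the coordinates of a jet chart to the coordinates of the jet space. -/
def jetEquiv (i : Fin (r + 1)) : (k : ℕ) → Model r k ≃L[ℂ] JetSpace r k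
  | 0 => (flatEquiv i).toContinuousLinearEquiv
  | k + 1 => ((jetEquiv i k).prodCongr (ContinuousLinearEquiv.refl ℂ (Fin r → ℂ))).trans
      (jetSnocEquiv r k).toContinuousLinearEquiv

lemma jetEquiv_succ (i : Fin (r + 1)) (k : ℕ) (y : Model r k) (w : Fin r → ℂ) :
    jetEquiv i (k + 1) (show Model r (k + 1) from (y, w)) =
      ((jetEquiv i k y).1, Fin.snoc (α := fun _ => Fin r → ℂ) (jetEquiv i k y).2 w) := rfl

lemma jetChart_succ_frame (i : Fin (r + 1)) (k : ℕ) (y : Model r k) (w : Fin r → ℂ)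
    (a : Fin (r + 1) → ℂ) :
    (jetChart r i (k + 1)).frame (show Model r (k + 1) from (y, w)) a =
      (show Model r (k + 1) from
        (a 0 • (jetChart r i k).frame y (Fin.cons 1 w), fun j => a j.succ)) := by
  rw [← Fin.insertNth_zero']
  rfl

/-- Frame components are read as dx (component 0) and du_k (the others). -/
lemma jetEquiv_frame (i : Fin (r + 1)) (k : ℕ) (y : Model r k) (a : Fin (r + 1) → ℂ) :
    (jetEquiv i k ((jetChart r i k).frame y a)).1 = a 0 ∧
      (jetEquiv i k ((jetChart r i k).frame y a)).2 (Fin.last k) = fun j => a j.succ := by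
  cases k with
  | zero =>
    have h : (jetChart r i 0).frame y a = i.insertNth (a 0) fun j => a j.succ :=
      flatChart_frame i y a
    rw [h]
    constructor
    · change (i.insertNth (a 0) (fun j => a j.succ) : Fin (r + 1) → ℂ) i = a 0
      simp
    · funext j
      change (i.insertNth (a 0) (fun j => a j.succ) : Fin (r + 1) → ℂ) (i.succAbove j) = a j.succ
      simp
  | succ k =>
    obtain ⟨y, w⟩ := y
    have h := jetEquiv_frame i k y (Fin.cons 1 w)
    erw [jetChart_succ_frame, jetEquiv_succ]
    refine ⟨?_, by simp⟩
    rw [map_smul, Prod.smul_fst, h.1]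
    simp

/-- One level up, a vector of the distribution is a multiple of the lift of the direction (1, w),
plus an arbitrary fiber part. Lying in the old distribution gives the old equations; being
proportional to (1, w) there gives the new one, du_k = w dx with w = u_{k+1}. -/
lemma exists_frame_eq_iff (i : Fin (r + 1)) (k : ℕ) (y v : Model r k) :
    (∃ a, (jetChart r i k).frame y a = v) ↔ ∀ j : Fin k,
      (jetEquiv i k v).2 j.castSucc = (jetEquiv i k v).1 • (jetEquiv i k y).2 j.succ := by
  induction k with
  | zero =>
    refine ⟨fun _ j => j.elim0, fun _ => ?_⟩
    refine ⟨Fin.cons ((v : Fin (r + 1) → ℂ) i) fun j => (v : Fin (r + 1) → ℂ) (i.succAbove j), ?_⟩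
    refine (flatChart_frame i y _).trans ?_
    funext j
    refine Fin.succAboveCases i ?_ (fun j => ?_) j <;> simp
  | succ k ih =>
    obtain ⟨y, w⟩ := y
    obtain ⟨v, b⟩ := v
    have h1 : (∃ a, (jetChart r i (k + 1)).frame (show Model r (k + 1) from (y, w)) a =
        (show Model r (k + 1) from (v, b))) ↔
          ∃ c : ℂ, c • (jetChart r i k).frame y (Fin.cons 1 w) = v := by
      constructor
      · rintro ⟨a, ha⟩
        rw [jetChart_succ_frame] at ha
        exact ⟨a 0, congrArg Prod.fst ha⟩
      · rintro ⟨c, rfl⟩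
        refine ⟨Fin.cons c b, ?_⟩
        rw [jetChart_succ_frame]
        rfl
    have h2 : (∀ j : Fin (k + 1),
        (jetEquiv i (k + 1) (show Model r (k + 1) from (v, b))).2 j.castSucc =
          (jetEquiv i (k + 1) (show Model r (k + 1) from (v, b))).1 •
            (jetEquiv i (k + 1) (show Model r (k + 1) from (y, w))).2 j.succ) ↔
        (∃ a, (jetChart r i k).frame y a = v) ∧
          (jetEquiv i k v).2 (Fin.last k) = (jetEquiv i k v).1 • w := by
      rw [jetEquiv_succ, jetEquiv_succ, Fin.forall_fin_succ', ih y v]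
      simp [← Fin.castSucc_succ]
    refine h1.trans (Iff.trans ?_ h2.symm)
    constructor
    · rintro ⟨c, rfl⟩
      refine ⟨⟨c • Fin.cons 1 w, map_smul _ _ _⟩, ?_⟩
      obtain ⟨h3, h4⟩ := jetEquiv_frame i k y (Fin.cons 1 w)
      rw [map_smul, Prod.smul_fst, Prod.smul_snd, Pi.smul_apply, h3, h4]
      simp
    · rintro ⟨⟨a, rfl⟩, h3⟩
      obtain ⟨h4, h5⟩ := jetEquiv_frame i k y a
      rw [h4, h5] at h3
      refine ⟨a 0, ?_⟩
      rw [← map_smul]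
      congr 1
      funext j
      refine Fin.cases (by simp) (fun j => ?_) j
      simpa using (congrFun h3 j).symm

lemma IsNonvertical.isLocallyJet {k : ℕ} {p : P r k} (h : IsNonvertical k p) :
    IsLocallyJet p := by
  obtain ⟨i, hi⟩ := isNonvertical_iff_exists_jetChart.1 h
  let L := jetEquiv i k
  let f := jetChart r i k
  have hL : ContMDiff 𝓘(ℂ, Model r k) 𝓘(ℂ, JetSpace r k) ω L := L.contDiff.contMDiff
  refine ⟨f.chart.trans L.toHomeomorph.toOpenPartialHomeomorph, ⟨hi, mem_univ _⟩, ?_, ?_, ?_⟩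
  · exact hL.comp_contMDiffOn
      ((contMDiffOn_of_mem_maximalAtlas f.mem_maximalAtlas).mono fun q hq => hq.1)
  · exact (contMDiffOn_symm_of_mem_maximalAtlas f.mem_maximalAtlas).comp
      L.symm.contDiff.contMDiff.contMDiffOn fun z _ => jetChart_target i k _
  · rintro q ⟨hq, -⟩ v
    have h1 := mfderiv_comp (I' := 𝓘(ℂ, Model r k)) q (g := L)
      (hL.contMDiffAt.mdifferentiableAt (by simp)) (f.mdiff.mdifferentiableAt hq)
    rw [mfderiv_eq_fderiv, L.fderiv] at h1
    have h2 : mfderiv 𝓘(ℂ, Model r k) 𝓘(ℂ, JetSpace r k)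
        (f.chart.trans L.toHomeomorph.toOpenPartialHomeomorph) q v =
          L (mfderiv 𝓘(ℂ, Model r k) 𝓘(ℂ, Model r k) f.chart q v) := DFunLike.congr_fun h1 v
    rw [h2]
    exact (f.mem_iff q hq v).trans (exists_frame_eq_iff i k _ _)

end Monster

end

theorem mainTheorem11 (r k : ℕ) :
    (∀ p : Monster.P r k,
      (Monster.IsCartan p ↔ ∀ (i : ℕ) (h : i ≤ k), ¬ Monster.IsVertical (Monster.proj h p)) ∧
      (Monster.IsCartan p ↔ Monster.code p = fun _ => Monster.Letter.R)) ∧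
    (IsOpen (Monster.cartanSet r k) ∧ Dense (Monster.cartanSet r k) ∧
      ∃ p : Monster.P r k, Monster.cartanSet r k = {q | Monster.Equivalent p q}) ∧
    (2 ≤ k → Monster.IsHypersurface (Monster.Model r k) (Monster.cartanSet r k)ᶜ ∧
      (1 ≤ r → (Monster.cartanSet r k)ᶜ.Nonempty)) ∧
    (∀ p : Monster.P r k, Monster.IsCartan p → Monster.IsLocallyJet p) ∧
    (∀ p : Monster.P r 1, Monster.IsCartan p) := by
  -- This holds for every `k`, with empty complement for k ≤ 1, so openness and density need no case
  -- distinction.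
  have hH : Monster.IsHypersurface (Monster.Model r k) (Monster.cartanSet r k)ᶜ := by
    rw [Monster.cartanSet_compl]
    exact Monster.isHypersurface_not_isNonvertical k
  refine ⟨fun p => ⟨Monster.isCartan_iff.trans Monster.isNonvertical_iff,
      Monster.isCartan_iff.trans Monster.code_eq_iff.symm⟩,
    ⟨isClosed_compl_iff.1 hH.isClosed, ?_, Monster.exists_cartanSet_eq_orbit r k⟩,
    fun hk => ⟨hH, fun hr => ?_⟩, fun p hp => (Monster.isCartan_iff.1 hp).isLocallyJet,
    -- Points of levels 0 and 1 are nonvertical by definition.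
    fun p => Monster.isCartan_iff.2 ⟨trivial, id⟩⟩
  · simpa using hH.dense_compl
  · obtain ⟨k, rfl⟩ := Nat.exists_eq_add_of_le' hk
    rw [Monster.cartanSet_compl]
    exact Monster.exists_not_isNonvertical hr k
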